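/- Let $j,k\ge 1$ be integers with $j+k<n$, and put $\ell=n-j-k\ge 1$. Let $G(n,j)$ be the set of affine $j$-planes in $\mathbb R^n$, and let $|\tau|$ be the distance from a plane $\tau$ to the origin. Each $\zeta\in G(n,k)$ is written as $\zeta=\eta+v$, where $\eta$ is a $k$-dimensional linear subspace and $v\in\eta^\perp$. The mixed Radon transform of $f:G(n,j)\to\mathbb C$ is $$(R_{j,k}f)(\zeta)=\int_{G_j(\eta^\perp)}d\xi\int_\eta f(\xi+u+v)\,du ,$$ where $d\xi$ is the $O(\eta^\perp)$-invariant probability measure on the Grassmannian $G_j(\eta^\perp)$ of $j$-dimensional linear subspaces of $\eta^\perp$, and $du$ is the Euclidean measure on $\eta$. The integral is said to exist in the Lebesgue sense if $(\xi,u)\mapsto f(\xi+u+v)$ is integrable on $G_j(\eta^\perp)\times\eta$. The transform $R_{k,j}$, taking functions on $G(n,k)$ to functions on $G(n,j)$, is defined in the same way with $j$ and $k$ interchanged. For $\alpha>0$ let $$(I^{\alpha}_{+,2}g)(t)=\frac{2}{\Gamma(\alpha)}\int_0^t(t^2-r^2)^{\alpha-1}g(r)\,r\,dr,\qquad (I^{\alpha}_{-,2}g)(t)=\frac{2}{\Gamma(\alpha)}\int_t^\infty(r^2-t^2)^{\alpha-1}g(r)\,r\,dr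 ,$$ and let $\sigma_{d-1}=2\pi^{d/2}/\Gamma(d/2)$. (1) Let $f_0$ be a complex-valued function on $(0,\infty)$, measurable and such that $$\int_0^a|f_0(t)|\,t^{n-j-1}\,dt<\infty\quad\text{and}\quad\int_a^\infty|f_0(t)|\,t^{k-1}\,dt<\infty$$ for some $a>0$. Let $f:G(n,j)\to\mathbb C$ satisfy $f(\tau)=f_0(|\tau|)$ whenever $|\tau|>0$. For $s>0$ put $$(I_{j,k}f_0)(s)=\frac{c_1}{s^{n-k-2}}\int_0^s(s^2-r^2)^{j/2-1}r^{\ell-1}\,dr\int_r^\infty f_0(t)\,(t^2-r^2)^{k/2-1}\,t\,dt,\qquad c_1=\frac{\sigma_{j-1}\sigma_{k-1}\sigma_{\ell-1}}{\sigma_{n-k-1}} .$$ (a) The double integral $(I_{j,k}f_0)(s)$ converges absolutely for almost every $s>0$. (b) For every $\zeta\in G(n,k)$ with $|\zeta|>0$, the integral $(R_{j,k}f)(\zeta)$ exists in the Lebesgue sense if and only if the double integral $(I_{j,k}f_0)(|\zeta|)$ converges absolutely, and in this case $$(R_{j,k}f)(\zeta)=(I_{j,k}f_0)(|\zeta|).$$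 (c) For all $s>0$ for which the double integral converges absolutely (hence for almost every $s>0$), $$(I_{j,k}f_0)(s)=\tilde c_1\,s^{k+2-n}\,\bigl(I^{j/2}_{+,2}\,r^{\ell-2}\,I^{k/2}_{-,2}f_0\bigr)(s),\qquad \tilde c_1=\frac{\pi^{k/2}\,\Gamma((n-k)/2)}{\Gamma(\ell/2)} .$$ (d) $\int_\alpha^\beta|(I_{j,k}f_0)(s)|\,ds<\infty$ for all $0<\alpha<\beta<\infty$. (2) The dual statement holds. If $\varphi_0$ is a complex-valued measurable function on $(0,\infty)$ with $\int_0^a|\varphi_0(s)|s^{n-k-1}ds<\infty$ and $\int_a^\infty|\varphi_0(s)|s^{j-1}ds<\infty$ for some $a>0$, and if $\varphi:G(n,k)\to\mathbb C$ satisfies $\varphi(\zeta)=\varphi_0(|\zeta|)$ whenever $|\zeta|>0$, then (a)–(d) hold with $R_{k,j}\varphi$ in place of $R_{j,k}f$ and with $j$ and $k$ interchanged throughout; the operator is $$(I^*_{j,k}\varphi_0)(t)=\frac{c_2}{t^{n-j-2}}\int_0^t(t^2-r^2)^{k/2-1}r^{\ell-1}dr\int_r^\infty\varphi_0(s)(s^2-r^2)^{j/2-1}s\,ds=\tilde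 c_2\,t^{j+2-n}\bigl(I^{k/2}_{+,2}\,r^{\ell-2}\,I^{j/2}_{-,2}\varphi_0\bigr)(t),$$ with $c_2=\sigma_{j-1}\sigma_{k-1}\sigma_{\ell-1}/\sigma_{n-j-1}$ and $\tilde c_2=\pi^{j/2}\,\Gamma((n-j)/2)/\Gamma(\ell/2)$. -/

import Mathlib

open MeasureTheory Set

noncomputable section

/-! ### Linear Grassmannians and their canonical probability measures -/

/-- The Grassmannian `G_j(V)` of `j`-dimensional linear subspaces of a real inner product
space `V`. -/
def LinGr (j : ℕ) (V : Type*) [NormedAddCommGroup V] [InnerProductSpace ℝ V] : Type _ :=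
  {ξ : Submodule ℝ V // Module.finrank ℝ ξ = j}

section LinearGrassmannian

variable {V : Type*} [NormedAddCommGroup V] [InnerProductSpace ℝ V] [FiniteDimensional ℝ V]
  [CompleteSpace V]

/-- The standard topology of `G_j(V)`: the one induced by identifying a subspace with the
orthogonal projection onto it. -/
instance LinGr.topology (j : ℕ) : TopologicalSpace (LinGr j V) :=
  TopologicalSpace.induced (fun ξ : LinGr j V => ξ.1.starProjection) inferInstance

/-- The Borel sets of `G_j(V)`. -/
instance LinGr.borelSets (j : ℕ) : MeasurableSpace (LinGr j V) := borel _

instance LinGr.isBorel (j : ℕ) : BorelSpace (LinGr j V) := ⟨rfl⟩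

/-- The orthogonal group `O(V)` is compact. -/
instance orthogonalGroup_compactSpace : CompactSpace (unitary (V →L[ℝ] V)) := by
  have : ProperSpace (V →L[ℝ] V) := FiniteDimensional.proper_real _
  refine isCompact_iff_compactSpace.mp
    (Metric.isCompact_of_isClosed_isBounded isClosed_unitary ?_)
  refine (Metric.isBounded_closedBall (x := (0 : V →L[ℝ] V)) (r := 1)).subset fun u hu => ?_
  rw [mem_closedBall_zero_iff]
  refine ContinuousLinearMap.opNorm_le_bound _ zero_le_one fun x => ?_
  rw [one_mul]
  exact ((Unitary.linearIsometryEquiv (⟨u, hu⟩ : unitary (V →L[ℝ] V))).norm_map x).le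

/-- The action of the orthogonal group `O(V)` on `G_j(V)`, `(g, ξ) ↦ gξ`. -/
def LinGr.rotate {j : ℕ} (g : unitary (V →L[ℝ] V)) (ξ : LinGr j V) : LinGr j V :=
  ⟨ξ.1.map (Unitary.linearIsometryEquiv g).toLinearEquiv.toLinearMap,
    (LinearEquiv.finrank_map_eq _ _).trans ξ.2⟩

variable (V) in
/-- The Haar probability measure of the orthogonal group `O(V)`. -/
def orthogonalHaar : Measure (unitary (V →L[ℝ] V)) := Measure.haarMeasure ⊤

open Classical in
variable (V) in
/-- The canonical (i.e. `O(V)`-invariant) probability measure of `G_j(V)`: the image of the Haar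
probability measure of `O(V)` under `g ↦ g ξ₀`, for some fixed `ξ₀`. It does not depend on the
choice of `ξ₀`. The measure is `0` if `G_j(V)` is empty. -/
def LinGr.canonicalMeasure (j : ℕ) : Measure (LinGr j V) :=
  if h : Nonempty (LinGr j V) then (orthogonalHaar V).map (fun g => LinGr.rotate g h.some) else 0

end LinearGrassmannian

/-! ### Affine Grassmannians and the mixed Radon transform -/

/-- The set `G(n, j)` of affine `j`-planes in `ℝⁿ`. -/
def AffGr (n j : ℕ) : Type :=
  {τ : AffineSubspace ℝ (EuclideanSpace ℝ (Fin n)) //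
    (τ : Set (EuclideanSpace ℝ (Fin n))).Nonempty ∧ Module.finrank ℝ τ.direction = j}

namespace AffGr

variable {n j k : ℕ}

/-- The distance `|τ|` from a plane to the origin. -/
def dist0 (τ : AffGr n j) : ℝ := Metric.infDist 0 (τ.1 : Set (EuclideanSpace ℝ (Fin n)))

/-- The linear subspace `η` in the parametrization `ζ = η + v`, `v ∈ η^⊥`. -/
def dir (ζ : AffGr n k) : Submodule ℝ (EuclideanSpace ℝ (Fin n)) := ζ.1.direction

/-- The vector `v ∈ η^⊥` in the parametrization `ζ = η + v`, that is, the point of `ζ` closest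
to the origin. -/
def foot (ζ : AffGr n k) : EuclideanSpace ℝ (Fin n) :=
  haveI : Nonempty ζ.1 := ζ.2.1.to_subtype
  (EuclideanGeometry.orthogonalProjection ζ.1 0 : ζ.1)

/-- The plane `ξ + p`, for a `j`-dimensional subspace `ξ` of a subspace `W` of `ℝⁿ` and
`p ∈ ℝⁿ`. -/
def translate {W : Submodule ℝ (EuclideanSpace ℝ (Fin n))} (ξ : LinGr j W)
    (p : EuclideanSpace ℝ (Fin n)) : AffGr n j :=
  ⟨AffineSubspace.mk' p (ξ.1.map W.subtype), AffineSubspace.mk'_nonempty _ _, by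
    rw [AffineSubspace.direction_mk', Submodule.finrank_map_subtype_eq]
    exact ξ.2⟩

end AffGr

section MixedRadon

variable {n j k : ℕ}

/-- The function `(ξ, u) ↦ f(ξ + u + v)` on `G_j(η^⊥) × η`, where `ζ = η + v`; it is `f`
restricted to the planes that meet `ζ` at a right angle. -/
def mixedIntegrand (f : AffGr n j → ℂ) (ζ : AffGr n k) : LinGr j ζ.dirᗮ × ζ.dir → ℂ :=
  fun p => f (AffGr.translate p.1 ((p.2 : EuclideanSpace ℝ (Fin n)) + ζ.foot))

/-- The mixed `j`-plane to `k`-plane Radon transform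
`(R_{j,k} f)(ζ) = ∫_{G_j(η^⊥)} dξ ∫_η f(ξ + u + v) du`, `ζ = η + v`. -/
def mixedRadon (f : AffGr n j → ℂ) (ζ : AffGr n k) : ℂ :=
  ∫ ξ, ∫ u, mixedIntegrand f ζ (ξ, u) ∂(volume : Measure ζ.dir)
    ∂(LinGr.canonicalMeasure ζ.dirᗮ j)

/-- The integral `(R_{j,k} f)(ζ)` exists in the Lebesgue sense. -/
def MixedRadonExists (f : AffGr n j → ℂ) (ζ : AffGr n k) : Prop :=
  Integrable (mixedIntegrand f ζ)
    ((LinGr.canonicalMeasure ζ.dirᗮ j).prod (volume : Measure ζ.dir))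

end MixedRadon

/-! ### Integrals on the half-line -/

/-- The Erdélyi–Kober fractional integral `I^α_{+,2}`. -/
def erdelyiKoberPlus (α : ℝ) (f : ℝ → ℂ) (t : ℝ) : ℂ :=
  (2 / Real.Gamma α) • ∫ r in Ioo 0 t, ((t ^ 2 - r ^ 2) ^ (α - 1) * r) • f r

/-- The Erdélyi–Kober fractional integral `I^α_{-,2}`. -/
def erdelyiKoberMinus (α : ℝ) (f : ℝ → ℂ) (t : ℝ) : ℂ :=
  (2 / Real.Gamma α) • ∫ r in Ioi t, ((r ^ 2 - t ^ 2) ^ (α - 1) * r) • f r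

/-- The area `2π^{d/2} / Γ(d/2)` of the unit sphere in `ℝᵈ`, i.e. `σ_{d-1}`. -/
def sphereArea (d : ℕ) : ℝ := 2 * Real.pi ^ ((d : ℝ) / 2) / Real.Gamma ((d : ℝ) / 2)

/-- The operator
`(I_{j,k} f₀)(s) = c₁ s^{k+2-n} ∫_0^s (s²-r²)^{j/2-1} r^{ℓ-1} dr ∫_r^∞ f₀(t) (t²-r²)^{k/2-1} t dt`,
where `ℓ = n - j - k` and `c₁ = σ_{j-1} σ_{k-1} σ_{ℓ-1} / σ_{n-k-1}`. -/
def radialTransform (n j k : ℕ) (f₀ : ℝ → ℂ) (s : ℝ) : ℂ :=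
  (sphereArea j * sphereArea k * sphereArea (n - j - k) / sphereArea (n - k)
      * s ^ ((k : ℤ) + 2 - n)) •
    ∫ r in Ioo 0 s, ((s ^ 2 - r ^ 2) ^ ((j : ℝ) / 2 - 1) * r ^ (n - j - k - 1)) •
      ∫ t in Ioi r, ((t ^ 2 - r ^ 2) ^ ((k : ℝ) / 2 - 1) * t) • f₀ t

/-- The double integral defining `(I_{j,k} f₀)(s)` is absolutely convergent. -/
def RadialTransformExists (n j k : ℕ) (f₀ : ℝ → ℂ) (s : ℝ) : Prop :=
  IntegrableOn
    (fun p : ℝ × ℝ =>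
      ((s ^ 2 - p.1 ^ 2) ^ ((j : ℝ) / 2 - 1) * p.1 ^ (n - j - k - 1)
        * ((p.2 ^ 2 - p.1 ^ 2) ^ ((k : ℝ) / 2 - 1) * p.2)) • f₀ p.2)
    {p : ℝ × ℝ | 0 < p.1 ∧ p.1 < s ∧ p.1 < p.2}

end

/-! ### Areas of spheres -/

noncomputable section

/-! Write ζ = η + v with s = |v| > 0, and take ξ ⊂ η^⊥, u ∈ η. The point of ξ + u + v nearest the
origin is u + w, where w = v - P_ξ v is orthogonal to u. With r = |w|, the plane lies at distance t
= √(|u|² + r²) (`AffGr.dist0_translate`). So everything rests on the image of the measure dξ du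
under (ξ, u) ↦ (r, t), which has density constant · kernel on {0 < r < s, r < t}
(`map_mixedLengths`). Existence and value of the Radon transform then pass to the double integral by
change of variables.

The law of r is found by exchanging the roles of ξ and v: averaging over rotations of ξ with v fixed
is averaging over directions of v with ξ fixed. The latter is computed by integrating a degree-zero
function of x ∈ V against a radial weight, with V = U ⊕ U^⊥ and polar coordinates in both summands
(`lintegral_norm_sub_starProjection`, `LinGr.lintegral_norm_sub_starProjection`). For fixed r, polar
coordinates in η give the law of t.

Almost everywhere convergence and local integrability come from one Tonelli estimate
(`lintegral_radial_lt_top`): the absolute double integral, weighted by s, is integrated over 0 < s <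
β. Integrating in s first leaves a constant and the cutoff r < β. Integrating in r next leaves a
weight W(t) on |f₀(t)|, with W(t) = O(t^(n-j-1)) for all t > 0 and W(t) = O(t^(k-1)) for t > a,
which are the two weights of the hypothesis.

The Erdélyi–Kober form is an identity between constants and powers. The dual statement is the same
theorem with j and k interchanged. -/

lemma sphereArea_eq_finrank_mul (d : ℕ) (hd : 0 < d) :
    sphereArea d = d * (√Real.pi ^ d / Real.Gamma (d / 2 + 1)) := by
  have hd' : (0 : ℝ) < d := by exact_mod_cast hd
  have hG : Real.Gamma ((d : ℝ) / 2) ≠ 0 := (Real.Gamma_pos_of_pos (by positivity)).ne'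
  rw [sphereArea, Real.Gamma_add_one (by positivity), Real.sqrt_eq_rpow, ← Real.rpow_natCast,
    ← Real.rpow_mul Real.pi_pos.le, show (1 / 2 * (d : ℝ)) = (d : ℝ) / 2 by ring]
  field_simp

lemma sphereArea_pos {d : ℕ} (hd : 0 < d) : 0 < sphereArea d := by
  have hd' : (0 : ℝ) < d := by exact_mod_cast hd
  have := Real.Gamma_pos_of_pos (show (0 : ℝ) < d / 2 by positivity)
  have := Real.pi_pos
  unfold sphereArea
  positivity

/-! ### Polar coordinates and the substitution t = √(y² + b²) -/

section Polar

variable {E : Type*} [NormedAddCommGroup E] [InnerProductSpace ℝ E] [FiniteDimensional ℝ E]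
  [MeasurableSpace E] [BorelSpace E]

open Measure in
lemma lintegral_fun_norm {d : ℕ} (hd : Module.finrank ℝ E = d) (hd0 : 0 < d) {F : ℝ → ENNReal}
    (hF : Measurable F) :
    ∫⁻ x : E, F ‖x‖ = ENNReal.ofReal (sphereArea d) *
      ∫⁻ y in Ioi (0 : ℝ), ENNReal.ofReal (y ^ (d - 1)) * F y := by
  have : Nontrivial E := Module.nontrivial_of_finrank_pos (R := ℝ) (hd ▸ hd0)
  calc
    ∫⁻ x : E, F ‖x‖ = ∫⁻ x : ({(0)}ᶜ : Set E), F ‖x.1‖ ∂((volume : Measure E).comap (↑)) := by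
      rw [lintegral_subtype_comap (measurableSet_singleton _).compl fun x ↦ F ‖x‖,
        restrict_compl_singleton]
    _ = ∫⁻ x, F x.2 ∂(volume : Measure E).toSphere.prod
          (.volumeIoiPow (Module.finrank ℝ E - 1)) := by
      simpa using ((volume : Measure E).measurePreserving_homeomorphUnitSphereProd).lintegral_comp
        (f := F ∘ Subtype.val ∘ Prod.snd)
        (hF.comp (measurable_subtype_coe.comp measurable_snd))
    _ = (volume : Measure E).toSphere univ *
          ∫⁻ x : Ioi (0 : ℝ), F x ∂.volumeIoiPow (Module.finrank ℝ E - 1) := by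
      rw [lintegral_prod _ (by fun_prop)]
      simp [mul_comm]
    _ = _ := by
      rw [toSphere_apply_univ, InnerProductSpace.volume_ball, hd, sphereArea_eq_finrank_mul d hd0,
        volumeIoiPow, lintegral_withDensity_eq_lintegral_mul _ (by fun_prop) (by fun_prop),
        ENNReal.ofReal_mul (by positivity)]
      simp only [ENNReal.ofReal_one, one_pow, one_mul, ENNReal.ofReal_natCast]
      congr 1
      exact lintegral_subtype_comap measurableSet_Ioi
        (fun y : ℝ => ENNReal.ofReal (y ^ (d - 1)) * F y)

/-- Substitute y = √(t² - b²), so that y^(d-1) dy = (t² - b²)^(d/2-1) t dt. This is the source of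
both kernels of the double integral. -/
lemma lintegral_Ioi_sqrt_sub {d : ℕ} (hd0 : 0 < d) {b : ℝ} (hb : 0 ≤ b)
    (F : ℝ → ENNReal) :
    ∫⁻ y in Ioi (0 : ℝ), ENNReal.ofReal (y ^ (d - 1)) * F √(y ^ 2 + b ^ 2) =
      ∫⁻ t in Ioi b, ENNReal.ofReal ((t ^ 2 - b ^ 2) ^ ((d : ℝ) / 2 - 1) * t) * F t := by
  have hpos : ∀ t ∈ Ioi b, 0 < t ^ 2 - b ^ 2 := fun t ht => by
    have : b < t := ht
    nlinarith
  have himg : (fun t => √(t ^ 2 - b ^ 2)) '' Ioi b = Ioi 0 := by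
    ext y
    constructor
    · rintro ⟨t, ht, rfl⟩
      exact Real.sqrt_pos.2 (hpos t ht)
    · intro (hy : 0 < y)
      refine ⟨√(y ^ 2 + b ^ 2), Real.lt_sqrt_of_sq_lt (by nlinarith), ?_⟩
      simp only
      rw [Real.sq_sqrt (by positivity), add_sub_cancel_right, Real.sqrt_sq hy.le]
  have hder : ∀ t ∈ Ioi b, HasDerivWithinAt (fun t => √(t ^ 2 - b ^ 2))
      (t / √(t ^ 2 - b ^ 2)) (Ioi b) t := fun t ht => by
    have h1 : HasDerivAt (fun t : ℝ => t ^ 2 - b ^ 2) (2 * t) t := by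
      simpa using (hasDerivAt_pow 2 t).sub_const (b ^ 2)
    have h2 := h1.sqrt (hpos t ht).ne'
    exact h2.hasDerivWithinAt.congr_deriv (mul_div_mul_left _ _ two_ne_zero)
  have hinj : InjOn (fun t => √(t ^ 2 - b ^ 2)) (Ioi b) := fun x hx y hy hxy => by
    have h1 := congrArg (fun z => z ^ 2) hxy
    simp only [Real.sq_sqrt (hpos x hx).le, Real.sq_sqrt (hpos y hy).le] at h1
    have hx' : b < x := hx
    have hy' : b < y := hy
    nlinarith [sq_nonneg (x - y)]
  rw [← himg, lintegral_image_eq_lintegral_abs_deriv_mul measurableSet_Ioi hder hinj]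
  refine setLIntegral_congr_fun measurableSet_Ioi fun t ht => ?_
  have ht0 : 0 < t := hb.trans_lt ht
  have hp := hpos t ht
  rw [Real.sq_sqrt hp.le, sub_add_cancel, Real.sqrt_sq ht0.le, ← mul_assoc,
    ← ENNReal.ofReal_mul (by positivity), abs_of_nonneg (by positivity)]
  congr 2
  have hs := Real.sqrt_pos.2 hp
  have : √(t ^ 2 - b ^ 2) ^ (d - 1) = (t ^ 2 - b ^ 2) ^ ((d : ℝ) / 2 - 1) * √(t ^ 2 - b ^ 2) := by
    rw [Real.sqrt_eq_rpow, ← Real.rpow_natCast, ← Real.rpow_mul hp.le, ← Real.rpow_add hp,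
      Nat.cast_sub hd0]
    congr 1
    push_cast
    ring
  rw [this]
  field_simp

lemma lintegral_fun_sqrt_norm_sq_add {d : ℕ} (hd : Module.finrank ℝ E = d) (hd0 : 0 < d)
    {b : ℝ} (hb : 0 ≤ b) {F : ℝ → ENNReal} (hF : Measurable F) :
    ∫⁻ x : E, F √(‖x‖ ^ 2 + b ^ 2) = ENNReal.ofReal (sphereArea d) *
      ∫⁻ t in Ioi b, ENNReal.ofReal ((t ^ 2 - b ^ 2) ^ ((d : ℝ) / 2 - 1) * t) * F t := by
  rw [← lintegral_Ioi_sqrt_sub hd0 hb]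
  exact lintegral_fun_norm hd hd0 (F := fun y => F √(y ^ 2 + b ^ 2)) (by fun_prop)

end Polar

/-! ### Scaling and Tonelli on the region 0 < b < t -/

lemma lintegral_Ioo_scale {s t : ℝ} (hs : 0 < s) (ht : 0 < t) (F : ℝ → ENNReal) :
    ∫⁻ b in Ioo 0 t, F b = ∫⁻ r in Ioo 0 s, ENNReal.ofReal (t / s) * F (t / s * r) := by
  have hts : 0 < t / s := by positivity
  have himg : (fun r => t / s * r) '' Ioo 0 s = Ioo 0 t := by
    rw [image_mul_left_Ioo hts, mul_zero, div_mul_cancel₀ _ hs.ne']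
  rw [← himg, lintegral_image_eq_lintegral_abs_deriv_mul measurableSet_Ioo
    (f' := fun _ => t / s) (fun x _ => by simpa using ((hasDerivAt_id x).const_mul (t / s)).hasDerivWithinAt)
    (mul_right_injective₀ hts.ne').injOn]
  simp [abs_of_pos hts]

lemma lintegral_Ioi_Ioi_swap (G : ℝ → ℝ → ENNReal) (hG : Measurable (Function.uncurry G)) :
    ∫⁻ b in Ioi (0 : ℝ), ∫⁻ t in Ioi b, G b t = ∫⁻ t in Ioi (0 : ℝ), ∫⁻ b in Ioo 0 t, G b t := by
  have hm : Measurable (Function.uncurry fun b t : ℝ =>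
      {p : ℝ × ℝ | 0 < p.1 ∧ p.1 < p.2}.indicator (Function.uncurry G) (b, t)) :=
    hG.indicator ((measurableSet_lt measurable_const measurable_fst).inter
      (measurableSet_lt measurable_fst measurable_snd))
  calc
    _ = ∫⁻ b, ∫⁻ t, {p : ℝ × ℝ | 0 < p.1 ∧ p.1 < p.2}.indicator (Function.uncurry G) (b, t) := by
      rw [← lintegral_indicator measurableSet_Ioi]
      congr 1 with b
      by_cases hb : 0 < b
      · rw [indicator_of_mem (mem_Ioi.2 hb), ← lintegral_indicator measurableSet_Ioi]
        congr 1 with t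
        simp [indicator, hb]
      · rw [indicator_of_notMem (by simpa using hb)]
        simp [indicator, hb]
    _ = ∫⁻ t, ∫⁻ b, {p : ℝ × ℝ | 0 < p.1 ∧ p.1 < p.2}.indicator (Function.uncurry G) (b, t) :=
      lintegral_lintegral_swap hm.aemeasurable
    _ = _ := by
      rw [← lintegral_indicator measurableSet_Ioi]
      congr 1 with t
      by_cases ht : 0 < t
      · rw [indicator_of_mem (mem_Ioi.2 ht), ← lintegral_indicator measurableSet_Ioo]
        congr 1 with b
      · rw [indicator_of_notMem (by simpa using ht)]
        refine (lintegral_congr fun b => ?_).trans lintegral_zero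
        simp only [indicator_apply_eq_zero, mem_ofPred_eq]
        intro h
        exact absurd (h.1.trans h.2) ht

lemma measurable_lintegral_Ioi {G : ℝ → ℝ → ENNReal} (hG : Measurable (Function.uncurry G)) :
    Measurable fun b => ∫⁻ t in Ioi b, G b t := by
  have hm : Measurable ({p : ℝ × ℝ | p.1 < p.2}.indicator (Function.uncurry G)) :=
    hG.indicator (measurableSet_lt measurable_fst measurable_snd)
  have := hm.lintegral_prod_right' (ν := volume)
  convert this using 2 with b
  rw [← lintegral_indicator measurableSet_Ioi]
  rfl

/-- The density, up to a constant, of the length of the projection of a random vector of length `s`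
in `d`-dimensional space to the orthogonal complement of a `j`-dimensional subspace. -/
def projDensity (d j : ℕ) (s r : ℝ) : ℝ :=
  s ^ ((2 : ℤ) - d) * ((s ^ 2 - r ^ 2) ^ ((j : ℝ) / 2 - 1) * r ^ (d - j - 1))

lemma measurable_projDensity (d j : ℕ) (s : ℝ) : Measurable (projDensity d j s) := by
  unfold projDensity
  fun_prop

/-- Homogeneity: under b = (t/s) r the polar weight in (b, t) splits into a function of r times
t^(d-1). -/
lemma projDensity_scale {d j : ℕ} (hjd : j < d) {s t r : ℝ} (hs : 0 < s)
    (ht : 0 < t) (hr : r ∈ Ioo 0 s) :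
    t / s * ((t / s * r) ^ (d - j - 1) *
      ((t ^ 2 - (t / s * r) ^ 2) ^ ((j : ℝ) / 2 - 1) * t)) = projDensity d j s r * t ^ (d - 1) := by
  have hts : 0 < t / s := by positivity
  have h1 : t ^ 2 - (t / s * r) ^ 2 = (t / s) ^ 2 * (s ^ 2 - r ^ 2) := by field_simp
  have h2 : 0 < s ^ 2 - r ^ 2 := by nlinarith [hr.1, hr.2]
  have h3 : ((t / s) ^ 2) ^ ((j : ℝ) / 2 - 1) = (t / s) ^ ((j : ℤ) - 2) := by
    rw [← Real.rpow_natCast, ← Real.rpow_mul hts.le, ← Real.rpow_intCast]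
    congr 1
    push_cast
    ring
  have h4 : (t / s) * ((t / s) ^ (d - j - 1) * (t / s) ^ ((j : ℤ) - 2)) * t =
      s ^ ((2 : ℤ) - d) * t ^ (d - 1) := by
    have e1 : (t / s) * ((t / s) ^ (d - j - 1) * (t / s) ^ ((j : ℤ) - 2)) =
        (t / s) ^ ((d : ℤ) - 2) := by
      rw [← zpow_natCast (t / s) (d - j - 1), ← zpow_add₀ hts.ne', ← zpow_one_add₀ hts.ne']
      congr 1
      omega
    rw [e1, div_zpow, div_mul_eq_mul_div, ← zpow_add_one₀ ht.ne', div_eq_mul_inv, ← zpow_neg,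
      mul_comm, ← zpow_natCast t]
    congr 2 <;> omega
  rw [h1, Real.mul_rpow (by positivity) h2.le, h3, mul_pow, projDensity]
  linear_combination ((s ^ 2 - r ^ 2) ^ ((j : ℝ) / 2 - 1) * r ^ (d - j - 1)) * h4

/-! ### Integration over V = U ⊕ U^⊥ -/

section Split

variable {V : Type*} [NormedAddCommGroup V] [InnerProductSpace ℝ V] [FiniteDimensional ℝ V]
  [MeasurableSpace V] [BorelSpace V]

lemma lintegral_orthogonal_split (U : Submodule ℝ V) (G : ℝ → ℝ → ENNReal)
    (hG : Measurable (Function.uncurry G)) :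
    ∫⁻ x : V, G ‖x‖ ‖x - U.starProjection x‖ =
      ∫⁻ y : Uᗮ, ∫⁻ x : U, G √(‖x‖ ^ 2 + ‖y‖ ^ 2) ‖y‖ := by
  have hmp := (WithLp.volume_preserving_ofLp U Uᗮ).comp
    (LinearIsometryEquiv.measurePreserving U.orthogonalDecomposition)
  have hm : Measurable fun p : U × Uᗮ => G √(‖p.1‖ ^ 2 + ‖p.2‖ ^ 2) ‖p.2‖ :=
    hG.comp (by fun_prop : Measurable fun p : U × Uᗮ => (√(‖p.1‖ ^ 2 + ‖p.2‖ ^ 2), ‖p.2‖))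
  have := hmp.lintegral_comp hm
  rw [Measure.volume_eq_prod, lintegral_prod_symm _ hm.aemeasurable] at this
  rw [← this]
  congr 1 with x
  have h1 := U.norm_sq_eq_add_norm_sq_projection x
  have h2 : ‖Uᗮ.orthogonalProjectionOnto x‖ = ‖x - U.starProjection x‖ := by
    rw [← Submodule.starProjection_orthogonal_val]
    rfl
  have h3 : √(‖U.orthogonalProjectionOnto x‖ ^ 2 + ‖Uᗮ.orthogonalProjectionOnto x‖ ^ 2) = ‖x‖ := by
    rw [← h1, Real.sqrt_sq (norm_nonneg _)]
  rw [h2] at h3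
  change _ = G √(‖(U.orthogonalDecomposition x).fst‖ ^ 2 + ‖(U.orthogonalDecomposition x).snd‖ ^ 2)
    ‖(U.orthogonalDecomposition x).snd‖
  rw [Submodule.fst_orthogonalDecomposition_apply, Submodule.snd_orthogonalDecomposition_apply, h2,
    h3]

/-- Length and direction separate: the ratio ‖x - Px‖ / ‖x‖ is independent of ‖x‖ under any radial
weight. The free scale s is later the length of the fixed vector v. -/
lemma lintegral_norm_sub_starProjection {d j : ℕ} (hd : Module.finrank ℝ V = d) (hj : 0 < j)
    (hjd : j < d) (U : Submodule ℝ V) (hU : Module.finrank ℝ U = j) {s : ℝ} (hs : 0 < s)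
    {w H : ℝ → ENNReal} (hw : Measurable w) (hH : Measurable H) :
    ∫⁻ x : V, w ‖x‖ * H (s * (‖x - U.starProjection x‖ / ‖x‖)) =
      ENNReal.ofReal (sphereArea j * sphereArea (d - j)) *
        (∫⁻ r in Ioo 0 s, ENNReal.ofReal (projDensity d j s r) * H r) *
        ∫⁻ t in Ioi (0 : ℝ), ENNReal.ofReal (t ^ (d - 1)) * w t := by
  have hUd : Module.finrank ℝ Uᗮ = d - j := by
    have := U.finrank_add_finrank_orthogonal
    omega
  have hσj := sphereArea_pos hj
  have hσl := sphereArea_pos (Nat.sub_pos_of_lt hjd)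
  set K : ℝ → ℝ → ENNReal := fun b t =>
    ENNReal.ofReal ((t ^ 2 - b ^ 2) ^ ((j : ℝ) / 2 - 1) * t) * (w t * H (s * (b / t))) with hK
  have hKm : Measurable (Function.uncurry K) := by
    simp only [hK, Function.uncurry_def]
    fun_prop
  have hm1 := measurable_lintegral_Ioi hKm
  rw [lintegral_orthogonal_split U (fun a b => w a * H (s * (b / a)))
    (by simp only [Function.uncurry_def]; fun_prop)]
  calc
    _ = ∫⁻ y : Uᗮ, ENNReal.ofReal (sphereArea j) * ∫⁻ t in Ioi ‖y‖, K ‖y‖ t := by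
      congr 1 with y
      exact lintegral_fun_sqrt_norm_sq_add hU hj (norm_nonneg y)
        (F := fun t => w t * H (s * (‖y‖ / t))) (by fun_prop)
    _ = ENNReal.ofReal (sphereArea j) * (ENNReal.ofReal (sphereArea (d - j)) *
          ∫⁻ b in Ioi (0 : ℝ), ∫⁻ t in Ioi b, ENNReal.ofReal (b ^ (d - j - 1)) * K b t) := by
      have hm2 : Measurable fun y : Uᗮ => ∫⁻ t in Ioi ‖y‖, K ‖y‖ t := hm1.comp measurable_norm
      rw [lintegral_const_mul _ hm2]
      congr 1
      rw [lintegral_fun_norm hUd (Nat.sub_pos_of_lt hjd) hm1]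
      congr 2 with b
      rw [lintegral_const_mul _ (by fun_prop)]
    _ = ENNReal.ofReal (sphereArea j * sphereArea (d - j)) *
          ∫⁻ t in Ioi (0 : ℝ), ∫⁻ b in Ioo 0 t, ENNReal.ofReal (b ^ (d - j - 1)) * K b t := by
      rw [lintegral_Ioi_Ioi_swap _ (by simp only [Function.uncurry_def] at hKm ⊢; fun_prop),
        ← mul_assoc, ENNReal.ofReal_mul hσj.le]
    _ = _ := by
      rw [mul_assoc]
      congr 1
      rw [← lintegral_const_mul _ (by fun_prop)]
      refine setLIntegral_congr_fun measurableSet_Ioi fun t (ht : 0 < t) => ?_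
      -- With b = (t/s) r the argument s · (b/t) of `H` becomes r, so the two integrals decouple.
      rw [lintegral_Ioo_scale hs ht, ← lintegral_mul_const]
      · refine setLIntegral_congr_fun measurableSet_Ioo fun r hr => ?_
        have hr0 : 0 < r := hr.1
        have h2 : 0 < t ^ 2 - (t / s * r) ^ 2 := by
          have : t / s * r < t := by
            rw [div_mul_eq_mul_div, div_lt_iff₀ hs]
            exact mul_lt_mul_of_pos_left hr.2 ht
          have : 0 < t / s * r := by positivity
          nlinarith
        have h3 : s * (t / s * r / t) = r := by field_simp
        have h4 : 0 ≤ projDensity d j s r := by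
          have : 0 < s ^ 2 - r ^ 2 := by nlinarith [hr.1, hr.2]
          unfold projDensity
          positivity
        simp only [hK]
        rw [h3]
        have key := congrArg ENNReal.ofReal (projDensity_scale hjd hs ht hr)
        rw [ENNReal.ofReal_mul (by positivity), ENNReal.ofReal_mul (by positivity),
          ENNReal.ofReal_mul h4] at key
        calc
          _ = ENNReal.ofReal (t / s) * (ENNReal.ofReal ((t / s * r) ^ (d - j - 1)) *
            ENNReal.ofReal ((t ^ 2 - (t / s * r) ^ 2) ^ ((j : ℝ) / 2 - 1) * t)) * (w t * H r) := by
              ring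
          _ = _ := by
              rw [key]
              ring
      · have := measurable_projDensity d j s
        fun_prop

end Split

lemma LinGr.nonempty_of_le {V : Type*} [NormedAddCommGroup V] [InnerProductSpace ℝ V]
    {j : ℕ} (hj : j ≤ Module.finrank ℝ V) : Nonempty (LinGr j V) := by
  obtain ⟨f, hf⟩ := exists_linearIndependent_of_le_finrank hj
  exact ⟨⟨Submodule.span ℝ (range f), by simpa using finrank_span_eq_card hf⟩⟩

lemma LinGr.measurable_norm_sub_starProjection {V : Type*} [NormedAddCommGroup V] [InnerProductSpace ℝ V]
    [FiniteDimensional ℝ V] {j : ℕ} (v : V) :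
    Measurable fun ξ : LinGr j V => ‖v - ξ.1.starProjection v‖ := by
  have h : Continuous fun ξ : LinGr j V => ξ.1.starProjection := continuous_induced_dom
  exact Continuous.measurable (by fun_prop)

lemma exists_unitary_apply_eq {V : Type*} [NormedAddCommGroup V] [InnerProductSpace ℝ V]
    [CompleteSpace V] {v w : V} (h : ‖v‖ = ‖w‖) :
    ∃ g : unitary (V →L[ℝ] V), (g : V →L[ℝ] V) v = w :=
  ⟨Unitary.linearIsometryEquiv.symm ((ℝ ∙ (v - w))ᗮ.reflection), Submodule.reflection_sub h⟩

/-! ### Distance of a fixed vector from a random subspace -/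

section GrassmannianLaw

variable {V : Type*} [NormedAddCommGroup V] [InnerProductSpace ℝ V] [FiniteDimensional ℝ V]
  [CompleteSpace V]

instance orthogonalHaar_isProbabilityMeasure : IsProbabilityMeasure (orthogonalHaar V) :=
  ⟨Measure.haarMeasure_self⟩

instance orthogonalHaar_isMulLeftInvariant : (orthogonalHaar V).IsMulLeftInvariant :=
  inferInstanceAs (Measure.haarMeasure _).IsMulLeftInvariant

/-- The topology is induced by projections, so this conjugation formula makes g ↦ gξ continuous. -/
lemma LinGr.starProjection_rotate {j : ℕ} (g : unitary (V →L[ℝ] V)) (ξ : LinGr j V) :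
    (LinGr.rotate g ξ).1.starProjection =
      (g : V →L[ℝ] V) * ξ.1.starProjection * (star g : unitary (V →L[ℝ] V)) := by
  ext x
  exact Submodule.starProjection_map_apply (Unitary.linearIsometryEquiv g) ξ.1 x

lemma LinGr.measurable_rotate {j : ℕ} (ξ : LinGr j V) :
    Measurable fun g : unitary (V →L[ℝ] V) => LinGr.rotate g ξ := by
  refine Continuous.measurable (continuous_induced_rng.2 ?_)
  have : Continuous fun g : unitary (V →L[ℝ] V) =>
      (g : V →L[ℝ] V) * ξ.1.starProjection * ((star g : unitary (V →L[ℝ] V)) : V →L[ℝ] V) := by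
    fun_prop
  convert this using 2 with g
  exact LinGr.starProjection_rotate g ξ

lemma LinGr.isProbabilityMeasure_canonicalMeasure {j : ℕ} (hj : j ≤ Module.finrank ℝ V) :
    IsProbabilityMeasure (LinGr.canonicalMeasure V j) := by
  have h := LinGr.nonempty_of_le hj
  rw [LinGr.canonicalMeasure, dif_pos h]
  exact Measure.isProbabilityMeasure_map (LinGr.measurable_rotate _).aemeasurable

lemma LinGr.norm_sub_starProjection_rotate {j : ℕ} (g : unitary (V →L[ℝ] V)) (ξ : LinGr j V)
    (v : V) : ‖v - (LinGr.rotate g ξ).1.starProjection v‖ =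
      ‖(star g : unitary (V →L[ℝ] V)).1 v - ξ.1.starProjection ((star g).1 v)‖ := by
  rw [LinGr.starProjection_rotate, ← Unitary.norm_map (star g)]
  congr 1
  rw [map_sub]
  congr 1
  change ((star g * g : unitary (V →L[ℝ] V)) : V →L[ℝ] V) _ = _
  rw [Unitary.star_mul_self]
  rfl

/-- Some orthogonal u maps v to w, and (ug)* w = g* v; left invariance of Haar measure absorbs u. -/
lemma lintegral_orthogonalHaar_star_apply {v w : V} (h : ‖v‖ = ‖w‖) (F : V → ENNReal) :
    ∫⁻ g, F ((star g : unitary (V →L[ℝ] V)).1 v) ∂(orthogonalHaar V) =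
      ∫⁻ g, F ((star g : unitary (V →L[ℝ] V)).1 w) ∂(orthogonalHaar V) := by
  obtain ⟨u, rfl⟩ := exists_unitary_apply_eq h
  symm
  rw [← lintegral_mul_left_eq_self _ u]
  congr 1 with g
  have : ((star g * star u * u : unitary (V →L[ℝ] V)) : V →L[ℝ] V) v = (star g).1 v := by
    rw [mul_assoc, Unitary.star_mul_self, mul_one]
  rw [star_mul, ← this]
  rfl

variable [MeasurableSpace V] [BorelSpace V]

lemma lintegral_star_apply (g : unitary (V →L[ℝ] V)) (F : V → ENNReal) (hF : Measurable F) :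
    ∫⁻ x, F ((star g : unitary (V →L[ℝ] V)).1 x) = ∫⁻ x, F x :=
  (LinearIsometryEquiv.measurePreserving (Unitary.linearIsometryEquiv (star g))).lintegral_comp hF

lemma measurable_star_apply :
    Measurable fun p : V × unitary (V →L[ℝ] V) => (star p.2 : unitary (V →L[ℝ] V)).1 p.1 := by
  have h : Continuous fun p : V × unitary (V →L[ℝ] V) =>
      (star p.2 : unitary (V →L[ℝ] V)).1 p.1 :=
    (continuous_subtype_val.comp (continuous_star.comp continuous_snd)).clm_apply continuous_fst
  exact h.measurable

/-- Tonelli: each rotation preserves both Lebesgue measure and the radial weight, and the Haar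
measure has mass one. -/
lemma lintegral_norm_mul_orthogonalHaar {w : ℝ → ENNReal} (hw : Measurable w)
    {F : V → ENNReal} (hF : Measurable F) :
    ∫⁻ x : V, w ‖x‖ * ∫⁻ g, F ((star g : unitary (V →L[ℝ] V)).1 x) ∂(orthogonalHaar V) =
      ∫⁻ x : V, w ‖x‖ * F x := by
  have hm : Measurable fun p : V × unitary (V →L[ℝ] V) =>
      F ((star p.2 : unitary (V →L[ℝ] V)).1 p.1) := hF.comp measurable_star_apply
  have h1 (x : V) : w ‖x‖ * ∫⁻ g, F ((star g : unitary (V →L[ℝ] V)).1 x) ∂(orthogonalHaar V) =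
      ∫⁻ g, w ‖x‖ * F ((star g : unitary (V →L[ℝ] V)).1 x) ∂(orthogonalHaar V) :=
    (lintegral_const_mul _ (hm.comp measurable_prodMk_left)).symm
  have h2 (g : unitary (V →L[ℝ] V)) :
      ∫⁻ x : V, w ‖x‖ * F ((star g : unitary (V →L[ℝ] V)).1 x) = ∫⁻ x : V, w ‖x‖ * F x := by
    rw [← lintegral_star_apply g (fun x => w ‖x‖ * F x) ((hw.comp measurable_norm).mul hF)]
    congr 1 with x
    rw [Unitary.norm_map]
  simp_rw [h1]
  rw [lintegral_lintegral_swap ((hw.comp measurable_fst.norm).mul hm).aemeasurable]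
  simp_rw [h2]
  simp

/-- Rotating ξ against v is rotating v against a fixed ξ, so the average is that of a degree-zero
function over directions. Integrating against a radial weight turns it into an integral over V. -/
lemma LinGr.lintegral_norm_sub_starProjection {d j : ℕ} (hd : Module.finrank ℝ V = d) (hj : 0 < j)
    (hjd : j < d) {v : V} (hv : 0 < ‖v‖) {H : ℝ → ENNReal} (hH : Measurable H) :
    ∫⁻ ξ, H ‖v - ξ.1.starProjection v‖ ∂(LinGr.canonicalMeasure V j) =
      ENNReal.ofReal (sphereArea j * sphereArea (d - j) / sphereArea d) *
        ∫⁻ r in Ioo 0 ‖v‖, ENNReal.ofReal (projDensity d j ‖v‖ r) * H r := by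
  have h := LinGr.nonempty_of_le (V := V) (j := j) (by omega)
  have hσd := sphereArea_pos (hj.trans hjd)
  have hcm : LinGr.canonicalMeasure V j = (orthogonalHaar V).map (fun g => LinGr.rotate g h.some) :=
    dif_pos h
  rw [hcm, lintegral_map (f := fun ξ : LinGr j V => H ‖v - ξ.1.starProjection v‖)
    (hH.comp (LinGr.measurable_norm_sub_starProjection v)) (LinGr.measurable_rotate _)]
  set ξ := h.some
  set s := ‖v‖ with hs
  set F : V → ENNReal := fun x => H (s * (‖x - ξ.1.starProjection x‖ / ‖x‖)) with hF
  have hFm : Measurable F := by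
    have : Measurable fun x : V => ‖x - ξ.1.starProjection x‖ :=
      Continuous.measurable (by fun_prop)
    fun_prop
  -- Normalized so that ∫ t^(d-1) w(t) dt = 1. It vanishes at 0, where the degree-zero function is
  -- not controlled.
  set w : ℝ → ENNReal := (Ioo 0 1).indicator fun t => ENNReal.ofReal (t ^ (d - 1))⁻¹ with hw
  have hwm : Measurable w := Measurable.indicator (by fun_prop) measurableSet_Ioo
  have hA : ∫⁻ t in Ioi (0 : ℝ), ENNReal.ofReal (t ^ (d - 1)) * w t = 1 := by
    have (t : ℝ) : ENNReal.ofReal (t ^ (d - 1)) * w t = (Ioo (0 : ℝ) 1).indicator 1 t := by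
      by_cases ht : t ∈ Ioo (0 : ℝ) 1
      · have ht0 : 0 < t := ht.1
        rw [hw, indicator_of_mem ht, indicator_of_mem ht, ← ENNReal.ofReal_mul (by positivity),
          mul_inv_cancel₀ (by positivity), ENNReal.ofReal_one, Pi.one_apply]
      · rw [hw, indicator_of_notMem ht, indicator_of_notMem ht, mul_zero]
    simp_rw [this]
    rw [setLIntegral_indicator measurableSet_Ioo, inter_eq_self_of_subset_left Ioo_subset_Ioi_self]
    simp
  set E := ∫⁻ g, F ((star g : unitary (V →L[ℝ] V)).1 v) ∂(orthogonalHaar V) with hE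
  have h1 : ∫⁻ g, H ‖v - (LinGr.rotate g ξ).1.starProjection v‖ ∂(orthogonalHaar V) = E := by
    congr 1 with g
    simp only [hF]
    rw [LinGr.norm_sub_starProjection_rotate, Unitary.norm_map, mul_div_cancel₀ _ hv.ne']
  rw [h1]
  have h2 := lintegral_norm_mul_orthogonalHaar (V := V) hwm hFm
  have h3 : ∀ x : V, w ‖x‖ * ∫⁻ g, F ((star g : unitary (V →L[ℝ] V)).1 x) ∂(orthogonalHaar V) =
      w ‖x‖ * E := by
    intro x
    by_cases hx : x = 0
    · simp [hx, hw]
    · congr 1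
      have hx' : 0 < ‖x‖ := norm_pos_iff.2 hx
      have e := lintegral_orthogonalHaar_star_apply (v := (s / ‖x‖) • x) (w := v)
        (by rw [norm_smul, Real.norm_of_nonneg (by positivity), div_mul_cancel₀ _ hx'.ne']) F
      rw [hE, ← e]
      congr 1 with g
      have hc : 0 < s / ‖x‖ := by positivity
      simp only [hF]
      rw [map_smul, map_smul, ← smul_sub, norm_smul, norm_smul,
        mul_div_mul_left _ _ (norm_pos_iff.2 hc.ne').ne']
  simp_rw [h3] at h2
  rw [lintegral_mul_const _ (by fun_prop), lintegral_fun_norm hd (hj.trans hjd) hwm,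
    _root_.lintegral_norm_sub_starProjection hd hj hjd ξ.1 ξ.2 hv hwm hH, hA, mul_one, mul_one]
    at h2
  have h0 : ENNReal.ofReal (sphereArea d) ≠ 0 := by simpa using hσd
  rw [ENNReal.ofReal_div_of_pos hσd, ← ENNReal.mul_right_inj h0 ENNReal.ofReal_ne_top, h2,
    ← mul_assoc, ENNReal.mul_div_cancel h0 ENNReal.ofReal_ne_top]

end GrassmannianLaw

/-! ### Distance of ξ + u + v from the origin -/

namespace AffGr

variable {n j k : ℕ}

lemma foot_mem (ζ : AffGr n k) : ζ.foot ∈ ζ.dirᗮ := by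
  have : Nonempty ζ.1 := ζ.2.1.to_subtype
  have := EuclideanGeometry.orthogonalProjection_vsub_mem_direction_orthogonal ζ.1
    (0 : EuclideanSpace ℝ (Fin n))
  rwa [vsub_eq_sub, sub_zero] at this

lemma norm_foot (ζ : AffGr n k) : ‖ζ.foot‖ = ζ.dist0 := by
  have : Nonempty ζ.1 := ζ.2.1.to_subtype
  rw [dist0, ← EuclideanGeometry.dist_orthogonalProjection_eq_infDist, dist_zero_left]
  rfl

/-- The foot of `ζ` as an element of the orthogonal complement of its direction. -/
def footPerp (ζ : AffGr n k) : ζ.dirᗮ := ⟨ζ.foot, ζ.foot_mem⟩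

lemma finrank_dir_orthogonal (ζ : AffGr n k) : Module.finrank ℝ ζ.dirᗮ = n - k := by
  have h := ζ.dir.finrank_add_finrank_orthogonal
  have h2 : Module.finrank ℝ ζ.dir = k := ζ.2.2
  rw [finrank_euclideanSpace_fin] at h
  omega

lemma dist0_translate (ζ : AffGr n k) (ξ : LinGr j ζ.dirᗮ) (u : ζ.dir) :
    (translate ξ ((u : EuclideanSpace ℝ (Fin n)) + ζ.foot)).dist0 =
      √(‖u‖ ^ 2 + ‖ζ.footPerp - ξ.1.starProjection ζ.footPerp‖ ^ 2) := by
  set τ := translate ξ ((u : EuclideanSpace ℝ (Fin n)) + ζ.foot) with hτ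
  set w := ζ.footPerp - ξ.1.starProjection ζ.footPerp with hw
  have : Nonempty τ.1 := τ.2.1.to_subtype
  have hdir : τ.1.direction = ξ.1.map ζ.dirᗮ.subtype := AffineSubspace.direction_mk' _ _
  have hfoot : (EuclideanGeometry.orthogonalProjection τ.1 0 : EuclideanSpace ℝ (Fin n)) =
      u + w := by
    rw [EuclideanGeometry.coe_orthogonalProjection_eq_iff_mem]
    constructor
    · change _ ∈ AffineSubspace.mk' _ _
      rw [AffineSubspace.mem_mk']
      refine ⟨-ξ.1.starProjection ζ.footPerp, neg_mem (Submodule.starProjection_apply_mem _ _), ?_⟩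
      simp [hw, footPerp]
    · rw [hdir, vsub_eq_sub, zero_sub]
      refine neg_mem (add_mem ?_ ?_)
      · rw [Submodule.mem_orthogonal]
        rintro _ ⟨y, -, rfl⟩
        have : inner ℝ (y : EuclideanSpace ℝ (Fin n)) (u : EuclideanSpace ℝ (Fin n)) = 0 :=
          Submodule.inner_left_of_mem_orthogonal u.2 y.2
        exact this
      · rw [Submodule.mem_orthogonal]
        rintro _ ⟨y, hy, rfl⟩
        have h1 : w ∈ ξ.1ᗮ := Submodule.sub_starProjection_mem_orthogonal _
        have h2 : inner ℝ y w = 0 := Submodule.inner_right_of_mem_orthogonal hy h1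
        exact h2
  rw [← norm_foot]
  change ‖(EuclideanGeometry.orthogonalProjection τ.1 0 : EuclideanSpace ℝ (Fin n))‖ = _
  rw [hfoot, eq_comm, Real.sqrt_eq_iff_mul_self_eq (by positivity) (norm_nonneg _),
    norm_add_mul_self_real, Submodule.inner_right_of_mem_orthogonal u.2 w.2]
  simp only [Submodule.coe_norm]
  ring

end AffGr

/-! ### Joint law of the two lengths -/

section MixedLaw

variable {n j k : ℕ}

/-- The lengths of the components of `u + v` orthogonal to `ξ + η` and to `ξ`, where `ζ = η + v`;
the second is the distance of `ξ + u + v` from the origin. -/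
def mixedLengths (ζ : AffGr n k) (p : LinGr j ζ.dirᗮ × ζ.dir) : ℝ × ℝ :=
  (‖ζ.footPerp - p.1.1.starProjection ζ.footPerp‖,
    √(‖p.2‖ ^ 2 + ‖ζ.footPerp - p.1.1.starProjection ζ.footPerp‖ ^ 2))

lemma measurable_mixedLengths (ζ : AffGr n k) : Measurable (mixedLengths (j := j) ζ) := by
  have h : Measurable fun p : LinGr j ζ.dirᗮ × ζ.dir =>
      ‖ζ.footPerp - p.1.1.starProjection ζ.footPerp‖ :=
    (LinGr.measurable_norm_sub_starProjection ζ.footPerp).comp measurable_fst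
  have h2 : Measurable fun p : LinGr j ζ.dirᗮ × ζ.dir => ‖p.2‖ := measurable_snd.norm
  unfold mixedLengths
  fun_prop

/-- The kernel of the transform of radial functions. -/
def radialKernel (n j k : ℕ) (s : ℝ) (p : ℝ × ℝ) : ℝ :=
  (s ^ 2 - p.1 ^ 2) ^ ((j : ℝ) / 2 - 1) * p.1 ^ (n - j - k - 1)
        * ((p.2 ^ 2 - p.1 ^ 2) ^ ((k : ℝ) / 2 - 1) * p.2)

/-- The constant factor of the transform of radial functions. -/
def radialConst (n j k : ℕ) (s : ℝ) : ℝ :=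
  sphereArea j * sphereArea k * sphereArea (n - j - k) / sphereArea (n - k)
      * s ^ ((k : ℤ) + 2 - n)

/-- The domain of integration of the transform of radial functions. -/
def radialDomain (s : ℝ) : Set (ℝ × ℝ) := {p : ℝ × ℝ | 0 < p.1 ∧ p.1 < s ∧ p.1 < p.2}

lemma measurable_radialKernel (n j k : ℕ) (s : ℝ) : Measurable (radialKernel n j k s) := by
  unfold radialKernel
  fun_prop

lemma measurableSet_radialDomain (s : ℝ) : MeasurableSet (radialDomain s) :=
  (measurableSet_lt measurable_const measurable_fst).inter
    ((measurableSet_lt measurable_fst measurable_const).inter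
      (measurableSet_lt measurable_fst measurable_snd))

lemma radialKernel_pos {s : ℝ} {p : ℝ × ℝ} (hp : p ∈ radialDomain s) :
    0 < radialKernel n j k s p := by
  obtain ⟨h1, h2, h3⟩ := hp
  have : 0 < s ^ 2 - p.1 ^ 2 := by nlinarith
  have : 0 < p.2 ^ 2 - p.1 ^ 2 := by nlinarith
  have := h1.trans h3
  unfold radialKernel
  positivity

lemma radialConst_pos (hj : 0 < j) (hk : 0 < k) (hjk : j + k < n) {s : ℝ} (hs : 0 < s) :
    0 < radialConst n j k s := by
  have := sphereArea_pos hj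
  have := sphereArea_pos hk
  have := sphereArea_pos (show 0 < n - j - k by omega)
  have := sphereArea_pos (show 0 < n - k by omega)
  unfold radialConst
  positivity

lemma lintegral_radialDomain {s : ℝ} {G : ℝ × ℝ → ENNReal} (hG : Measurable G) :
    ∫⁻ p in radialDomain s, G p = ∫⁻ r in Ioo 0 s, ∫⁻ t in Ioi r, G (r, t) := by
  rw [← lintegral_indicator (measurableSet_radialDomain s), Measure.volume_eq_prod,
    lintegral_prod _ (hG.indicator (measurableSet_radialDomain s)).aemeasurable,
    ← lintegral_indicator measurableSet_Ioo]
  congr 1 with r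
  by_cases hr : r ∈ Ioo 0 s
  · rw [indicator_of_mem hr, ← lintegral_indicator measurableSet_Ioi]
    congr 1 with t
    simp [indicator, radialDomain, hr.1, hr.2]
  · rw [indicator_of_notMem hr]
    refine (lintegral_congr fun t => ?_).trans lintegral_zero
    simp only [indicator_apply_eq_zero]
    intro h
    exact absurd ⟨h.1, h.2.1⟩ hr

/-- For fixed ξ, polar coordinates in η turn the u-integral into an integral over t > r depending on
ξ only through r; the law of r in η^⊥, of dimension n - k, does the rest. -/
lemma lintegral_mixedLengths (hj : 0 < j) (hk : 0 < k) (hjk : j + k < n) (ζ : AffGr n k)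
    (hζ : 0 < ζ.dist0) {G : ℝ × ℝ → ENNReal} (hG : Measurable G) :
    ∫⁻ p, G (mixedLengths ζ p) ∂((LinGr.canonicalMeasure ζ.dirᗮ j).prod volume) =
      ∫⁻ p in radialDomain ζ.dist0,
        ENNReal.ofReal (radialConst n j k ζ.dist0 * radialKernel n j k ζ.dist0 p) * G p := by
  have hd := ζ.finrank_dir_orthogonal
  have hk' : Module.finrank ℝ ζ.dir = k := ζ.2.2
  have hs : ‖ζ.footPerp‖ = ζ.dist0 := ζ.norm_foot
  have hprob := LinGr.isProbabilityMeasure_canonicalMeasure (V := ζ.dirᗮ) (j := j) (by omega)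
  have hσk := sphereArea_pos hk
  set K : ℝ → ℝ → ENNReal := fun r t =>
    ENNReal.ofReal ((t ^ 2 - r ^ 2) ^ ((k : ℝ) / 2 - 1) * t) * G (r, t) with hK
  have hKm : Measurable (Function.uncurry K) := by
    simp only [hK, Function.uncurry_def]
    fun_prop
  have hm1 := measurable_lintegral_Ioi hKm
  have hpd := measurable_projDensity (n - k) j ζ.dist0
  have hrk := measurable_radialKernel n j k ζ.dist0
  rw [lintegral_prod (fun p : LinGr j ζ.dirᗮ × ζ.dir => G (mixedLengths ζ p))
      (hG.comp (measurable_mixedLengths ζ)).aemeasurable,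
    lintegral_radialDomain (by fun_prop)]
  set T : ℝ → ENNReal := fun r => ENNReal.ofReal (sphereArea k) * ∫⁻ t in Ioi r, K r t with hT
  calc
    _ = ∫⁻ ξ : LinGr j ζ.dirᗮ, T ‖ζ.footPerp - ξ.1.starProjection ζ.footPerp‖ ∂(LinGr.canonicalMeasure ζ.dirᗮ j) := by
      congr 1 with ξ
      exact lintegral_fun_sqrt_norm_sq_add hk' hk
        (norm_nonneg (ζ.footPerp - ξ.1.starProjection ζ.footPerp))
        (F := fun t => G (‖ζ.footPerp - ξ.1.starProjection ζ.footPerp‖, t)) (by fun_prop)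
    _ = _ := by
      refine (LinGr.lintegral_norm_sub_starProjection hd hj (by omega) (hs ▸ hζ)
        (by fun_prop)).trans ?_
      rw [hs, ← lintegral_const_mul _ (by fun_prop)]
      refine setLIntegral_congr_fun measurableSet_Ioo fun r hr => ?_
      have hr0 : 0 < r := hr.1
      have h2 : 0 < ζ.dist0 ^ 2 - r ^ 2 := by nlinarith [hr.1, hr.2]
      have hσj := sphereArea_pos hj
      have hσl := sphereArea_pos (show 0 < n - k - j by omega)
      have hσd := sphereArea_pos (show 0 < n - k by omega)
      have h4 : 0 ≤ projDensity (n - k) j ζ.dist0 r := by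
        unfold projDensity
        positivity
      simp only [hT]
      rw [← mul_assoc (ENNReal.ofReal (projDensity _ _ _ _)), ← ENNReal.ofReal_mul h4, ← mul_assoc,
        ← ENNReal.ofReal_mul (by positivity), ← lintegral_const_mul _ (by fun_prop)]
      refine setLIntegral_congr_fun measurableSet_Ioi fun t ht => ?_
      simp only [hK]
      rw [← mul_assoc (ENNReal.ofReal _), ← ENNReal.ofReal_mul (by positivity)]
      congr 2
      have hz : (2 : ℤ) - ((n - k : ℕ) : ℤ) = k + 2 - n := by omega
      rw [projDensity, hz, radialConst, radialKernel, Nat.sub_right_comm n j k]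
      ring

end MixedLaw

/-! ### From the Radon transform to the double integral -/

section RadialReduction

variable {n j k : ℕ}

lemma map_mixedLengths (hj : 0 < j) (hk : 0 < k) (hjk : j + k < n) (ζ : AffGr n k)
    (hζ : 0 < ζ.dist0) :
    ((LinGr.canonicalMeasure ζ.dirᗮ j).prod volume).map (mixedLengths ζ) =
      (volume.restrict (radialDomain ζ.dist0)).withDensity
        fun p => ENNReal.ofReal (radialConst n j k ζ.dist0 * radialKernel n j k ζ.dist0 p) := by
  have hrk := measurable_radialKernel n j k ζ.dist0
  refine Measure.ext_of_lintegral _ fun G hG => ?_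
  rw [lintegral_map hG (measurable_mixedLengths ζ), lintegral_mixedLengths hj hk hjk ζ hζ hG,
    lintegral_withDensity_eq_lintegral_mul _ (by fun_prop) hG]
  rfl

/-- The values of f on planes through the origin do not matter: the joint law lives where t > r > 0.
-/
lemma ae_mixedIntegrand_eq (hj : 0 < j) (hk : 0 < k) (hjk : j + k < n) {f : AffGr n j → ℂ}
    {f₀ : ℝ → ℂ} (hf : ∀ τ : AffGr n j, 0 < τ.dist0 → f τ = f₀ τ.dist0) (ζ : AffGr n k)
    (hζ : 0 < ζ.dist0) :
    mixedIntegrand f ζ =ᵐ[(LinGr.canonicalMeasure ζ.dirᗮ j).prod volume]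
      (fun p => f₀ p.2) ∘ mixedLengths ζ := by
  have h : ∀ᵐ p ∂(((LinGr.canonicalMeasure ζ.dirᗮ j).prod volume).map (mixedLengths ζ)),
      p ∈ radialDomain ζ.dist0 := by
    rw [map_mixedLengths hj hk hjk ζ hζ]
    exact (withDensity_absolutelyContinuous _ _).ae_le
      (ae_restrict_mem (measurableSet_radialDomain _))
  filter_upwards [ae_of_ae_map (measurable_mixedLengths ζ).aemeasurable h] with p hp
  have hd : (AffGr.translate p.1 ((p.2 : EuclideanSpace ℝ (Fin n)) + ζ.foot)).dist0 =
      (mixedLengths ζ p).2 := ζ.dist0_translate p.1 p.2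
  have hpos : 0 < (mixedLengths ζ p).2 := hp.1.trans hp.2.2
  rw [mixedIntegrand, hf _ (hd ▸ hpos), hd]
  rfl

/-- Carries almost-everywhere information about f₀ on (0, ∞) over to (r, t) ↦ f₀(t). -/
lemma restrict_radialDomain_le (s : ℝ) : (volume : Measure (ℝ × ℝ)).restrict (radialDomain s) ≤
    (volume : Measure ℝ).prod (volume.restrict (Ioi 0)) := by
  have h : (volume : Measure ℝ).prod ((volume : Measure ℝ).restrict (Ioi 0)) =
      (volume : Measure (ℝ × ℝ)).restrict (univ ×ˢ Ioi 0) := by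
    rw [Measure.volume_eq_prod, ← Measure.prod_restrict, Measure.restrict_univ]
  rw [h]
  refine Measure.restrict_mono ?_ le_rfl
  rintro p ⟨h1, -, h2⟩
  exact ⟨trivial, h1.trans h2⟩

lemma aestronglyMeasurable_comp_snd_radialDomain {f₀ : ℝ → ℂ}
    (hf₀ : AEStronglyMeasurable f₀ (volume.restrict (Ioi 0))) (s : ℝ) :
    AEStronglyMeasurable (fun p : ℝ × ℝ => f₀ p.2) (volume.restrict (radialDomain s)) := by
  have h : AEStronglyMeasurable (fun p : ℝ × ℝ => f₀ p.2)
      ((volume : Measure ℝ).prod (volume.restrict (Ioi 0))) := hf₀.comp_snd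
  exact h.mono_measure (restrict_radialDomain_le s)

lemma setIntegral_radialDomain {s : ℝ} {G : ℝ × ℝ → ℂ} (hG : IntegrableOn G (radialDomain s)) :
    ∫ p in radialDomain s, G p = ∫ r in Ioo 0 s, ∫ t in Ioi r, G (r, t) := by
  rw [← integral_indicator (measurableSet_radialDomain s), Measure.volume_eq_prod,
    integral_prod _ ((integrable_indicator_iff (measurableSet_radialDomain s)).2 hG),
    ← integral_indicator measurableSet_Ioo]
  congr 1 with r
  by_cases hr : r ∈ Ioo 0 s
  · rw [indicator_of_mem hr, ← integral_indicator measurableSet_Ioi]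
    congr 1 with t
    simp [indicator, radialDomain, hr.1, hr.2]
  · rw [indicator_of_notMem hr]
    refine integral_eq_zero_of_ae (Filter.Eventually.of_forall fun t => ?_)
    simp only [Pi.zero_apply, indicator_apply_eq_zero]
    intro h
    exact absurd ⟨h.1, h.2.1⟩ hr

lemma radialTransform_eq_setIntegral {f₀ : ℝ → ℂ} {s : ℝ}
    (h : RadialTransformExists n j k f₀ s) :
    radialTransform n j k f₀ s = radialConst n j k s •
      ∫ p in radialDomain s, radialKernel n j k s p • f₀ p.2 := by
  rw [setIntegral_radialDomain (G := fun p => radialKernel n j k s p • f₀ p.2) h, radialTransform,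
    radialConst]
  congr 1
  refine setIntegral_congr_fun measurableSet_Ioo fun r _ => ?_
  simp only [radialKernel, mul_smul _ (_ * _), integral_smul]

theorem mixedRadonExists_iff (hj : 0 < j) (hk : 0 < k) (hjk : j + k < n) {f : AffGr n j → ℂ}
    {f₀ : ℝ → ℂ} (hf : ∀ τ : AffGr n j, 0 < τ.dist0 → f τ = f₀ τ.dist0)
    (hf₀ : AEStronglyMeasurable f₀ (volume.restrict (Ioi 0))) (ζ : AffGr n k)
    (hζ : 0 < ζ.dist0) :
    MixedRadonExists f ζ ↔ RadialTransformExists n j k f₀ ζ.dist0 := by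
  have hrk := measurable_radialKernel n j k ζ.dist0
  have hc := radialConst_pos hj hk hjk hζ
  have hm := aestronglyMeasurable_comp_snd_radialDomain hf₀ ζ.dist0
  rw [MixedRadonExists, integrable_congr (ae_mixedIntegrand_eq hj hk hjk hf ζ hζ),
    ← integrable_map_measure _ (measurable_mixedLengths ζ).aemeasurable,
    map_mixedLengths hj hk hjk ζ hζ, integrable_withDensity_iff_integrable_smul' (by fun_prop)
      (by simp)]
  · have : (fun p : ℝ × ℝ => (ENNReal.ofReal
        (radialConst n j k ζ.dist0 * radialKernel n j k ζ.dist0 p)).toReal • f₀ p.2)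
        =ᵐ[volume.restrict (radialDomain ζ.dist0)]
        radialConst n j k ζ.dist0 • fun p => radialKernel n j k ζ.dist0 p • f₀ p.2 := by
      filter_upwards [ae_restrict_mem (measurableSet_radialDomain _)] with p hp
      rw [ENNReal.toReal_ofReal (mul_nonneg hc.le (radialKernel_pos hp).le), mul_smul]
      rfl
    rw [integrable_congr this, integrable_smul_iff hc.ne']
    rfl
  · rw [map_mixedLengths hj hk hjk ζ hζ]
    exact hm.mono_ac (withDensity_absolutelyContinuous _ _)

theorem mixedRadon_eq_radialTransform (hj : 0 < j) (hk : 0 < k) (hjk : j + k < n)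
    {f : AffGr n j → ℂ} {f₀ : ℝ → ℂ} (hf : ∀ τ : AffGr n j, 0 < τ.dist0 → f τ = f₀ τ.dist0)
    (hf₀ : AEStronglyMeasurable f₀ (volume.restrict (Ioi 0))) (ζ : AffGr n k)
    (hζ : 0 < ζ.dist0) (h : MixedRadonExists f ζ) :
    mixedRadon f ζ = radialTransform n j k f₀ ζ.dist0 := by
  have hrk := measurable_radialKernel n j k ζ.dist0
  have hc := radialConst_pos hj hk hjk hζ
  have hm := aestronglyMeasurable_comp_snd_radialDomain hf₀ ζ.dist0
  have hprob := LinGr.isProbabilityMeasure_canonicalMeasure (V := ζ.dirᗮ) (j := j)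
    (by rw [ζ.finrank_dir_orthogonal]; omega)
  rw [radialTransform_eq_setIntegral ((mixedRadonExists_iff hj hk hjk hf hf₀ ζ hζ).1 h),
    mixedRadon, ← integral_prod _ h, integral_congr_ae (ae_mixedIntegrand_eq hj hk hjk hf ζ hζ)]
  refine (integral_map (f := fun q : ℝ × ℝ => f₀ q.2)
    (measurable_mixedLengths ζ).aemeasurable ?_).symm.trans ?_
  · rw [map_mixedLengths hj hk hjk ζ hζ]
    exact hm.mono_ac (withDensity_absolutelyContinuous _ _)
  rw [map_mixedLengths hj hk hjk ζ hζ, integral_withDensity_eq_integral_toReal_smul (by fun_prop)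
      (by simp), ← integral_smul]
  refine setIntegral_congr_fun (measurableSet_radialDomain _) fun p hp => ?_
  rw [ENNReal.toReal_ofReal (mul_nonneg hc.le (radialKernel_pos hp).le), mul_smul]

end RadialReduction

/-! ### The Tonelli estimate -/

section RadialEstimates

/-- A positive multiple of this density is a probability law, so the Beta-type integral is finite
without being evaluated. -/
lemma lintegral_projDensity_one_ne_top {d j : ℕ} (hj : 0 < j) (hjd : j < d) :
    ∫⁻ r in Ioo 0 1, ENNReal.ofReal (projDensity d j 1 r) ≠ ⊤ := by
  have hd : Module.finrank ℝ (EuclideanSpace ℝ (Fin d)) = d := finrank_euclideanSpace_fin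
  have hprob := LinGr.isProbabilityMeasure_canonicalMeasure (V := EuclideanSpace ℝ (Fin d))
    (j := j) (by omega)
  have hv : ‖EuclideanSpace.single (⟨0, by omega⟩ : Fin d) (1 : ℝ)‖ = 1 := by simp
  have h := LinGr.lintegral_norm_sub_starProjection hd hj hjd
    (v := EuclideanSpace.single (⟨0, by omega⟩ : Fin d) (1 : ℝ)) (by simp) (H := fun _ => 1)
    measurable_const
  have hc : 0 < sphereArea j * sphereArea (d - j) / sphereArea d := by
    have := sphereArea_pos hj
    have := sphereArea_pos (show 0 < d - j by omega)
    have := sphereArea_pos (show 0 < d by omega)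
    positivity
  simp only [hv, mul_one, lintegral_const, measure_univ] at h
  intro htop
  rw [htop, ENNReal.mul_top (by simpa using hc)] at h
  exact ENNReal.one_ne_top h

lemma lintegral_Ioo_kernel_eq {ℓ k : ℕ} (hℓ : 0 < ℓ) {t : ℝ} (ht : 0 < t) :
    ∫⁻ r in Ioo 0 t, ENNReal.ofReal (r ^ (ℓ - 1) * ((t ^ 2 - r ^ 2) ^ ((k : ℝ) / 2 - 1) * t)) =
      (∫⁻ r in Ioo 0 1, ENNReal.ofReal (projDensity (ℓ + k) k 1 r)) *
        ENNReal.ofReal (t ^ (ℓ + k - 1)) := by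
  have hm := measurable_projDensity (ℓ + k) k 1
  rw [lintegral_Ioo_scale one_pos ht, ← lintegral_mul_const _ (by fun_prop)]
  refine setLIntegral_congr_fun measurableSet_Ioo fun r hr => ?_
  have hr0 : 0 < r := hr.1
  have h4 : 0 ≤ projDensity (ℓ + k) k 1 r := by
    have : 0 < (1 : ℝ) ^ 2 - r ^ 2 := by nlinarith [hr.1, hr.2]
    unfold projDensity
    positivity
  have hs := projDensity_scale (d := ℓ + k) (j := k) (by omega) one_pos ht hr
  rw [Nat.add_sub_cancel] at hs
  rw [← ENNReal.ofReal_mul (by positivity), ← ENNReal.ofReal_mul h4, hs]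

lemma kernel_le_of_two_mul_le {k : ℕ} (hk : 0 < k) {t r : ℝ} (hr : 0 ≤ r) (ht : 0 < t)
    (hrt : 2 * r ≤ t) : (t ^ 2 - r ^ 2) ^ ((k : ℝ) / 2 - 1) * t ≤ 2 * t ^ (k - 1) := by
  set x : ℝ := 1 - (r / t) ^ 2 with hx
  have hrt' : r / t ≤ 1 / 2 := by
    rw [div_le_div_iff₀ ht two_pos]
    linarith
  have hrt0 : 0 ≤ r / t := by positivity
  have hx1 : 1 / 2 ≤ x := by nlinarith
  have hx2 : x ≤ 1 := by nlinarith
  have h1 : t ^ 2 - r ^ 2 = t ^ 2 * x := by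
    rw [hx]
    field_simp
  have h2 : (t ^ 2) ^ ((k : ℝ) / 2 - 1) * t = t ^ (k - 1) := by
    rw [← Real.rpow_natCast, ← Real.rpow_mul ht.le, ← Real.rpow_natCast t (k - 1),
      Nat.cast_sub hk, ← Real.rpow_add_one ht.ne']
    congr 1
    push_cast
    ring
  have h3 : x ^ ((k : ℝ) / 2 - 1) ≤ 2 := by
    calc
      -- The exponent is at least -1 and 1/2 ≤ x ≤ 1, which covers the singular case k = 1.
      x ^ ((k : ℝ) / 2 - 1) ≤ x ^ (-1 : ℝ) :=
        Real.rpow_le_rpow_of_exponent_ge (by linarith) hx2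
          (by linarith [show (0 : ℝ) ≤ k / 2 by positivity])
      _ = x⁻¹ := Real.rpow_neg_one x
      _ ≤ 2 := by
        rw [inv_le_comm₀ (by linarith) two_pos]
        linarith
  rw [h1, Real.mul_rpow (by positivity) (by linarith), mul_right_comm, h2, mul_comm]
  exact mul_le_mul_of_nonneg_right h3 (by positivity)

lemma lintegral_Ioo_kernel_le {ℓ k : ℕ} (hk : 0 < k) {β t : ℝ} (hβ : 0 < β)
    (ht : 2 * β ≤ t) :
    ∫⁻ r in Ioo 0 t, (Iio β).indicator 1 r *
        ENNReal.ofReal (r ^ (ℓ - 1) * ((t ^ 2 - r ^ 2) ^ ((k : ℝ) / 2 - 1) * t)) ≤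
      ENNReal.ofReal (2 * β ^ (ℓ - 1) * β) * ENNReal.ofReal (t ^ (k - 1)) := by
  have ht0 : 0 < t := by linarith
  calc
    _ ≤ ∫⁻ r, (Ioo 0 β).indicator
          (fun _ => ENNReal.ofReal (β ^ (ℓ - 1) * (2 * t ^ (k - 1)))) r := by
      rw [← lintegral_indicator measurableSet_Ioo]
      refine lintegral_mono fun r => ?_
      by_cases hr : r ∈ Ioo 0 β
      · have hr0 : 0 < r := hr.1
        have hr1 : r < β := hr.2
        rw [indicator_of_mem (show r ∈ Ioo 0 t from ⟨hr0, by linarith⟩), indicator_of_mem hr,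
          indicator_of_mem (show r ∈ Iio β from hr1), Pi.one_apply, one_mul]
        refine ENNReal.ofReal_le_ofReal ?_
        have hk := kernel_le_of_two_mul_le hk hr0.le ht0 (by linarith)
        have hp : 0 < t ^ 2 - r ^ 2 := by nlinarith
        gcongr
      · rw [indicator_of_notMem hr]
        refine le_of_eq (indicator_apply_eq_zero.2 fun hr' => ?_)
        rw [indicator_of_notMem (show r ∉ Iio β from fun h => hr ⟨hr'.1, h⟩), zero_mul]
    _ = _ := by
      rw [lintegral_indicator measurableSet_Ioo, setLIntegral_const, Real.volume_Ioo, sub_zero,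
        ← ENNReal.ofReal_mul (by positivity), ← ENNReal.ofReal_mul (by positivity)]
      congr 1
      ring

/-- Undoing s = √(y² + r²) replaces the singular kernel by y^(j-1), and s < β forces both y < β and
r < β. -/
lemma lintegral_Ioi_indicator_le {j : ℕ} (hj : 0 < j) {β r : ℝ} (hr : 0 ≤ r) :
    ∫⁻ s in Ioi r, ENNReal.ofReal ((s ^ 2 - r ^ 2) ^ ((j : ℝ) / 2 - 1) * s) *
        (Iio β).indicator 1 s ≤
      ENNReal.ofReal (β ^ (j - 1)) * ENNReal.ofReal β * (Iio β).indicator 1 r := by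
  rw [← lintegral_Ioi_sqrt_sub hj hr]
  calc
    _ ≤ ∫⁻ y, (Ioo 0 β).indicator
          (fun _ => ENNReal.ofReal (β ^ (j - 1)) * (Iio β).indicator 1 r) y := by
      rw [← lintegral_indicator measurableSet_Ioi]
      refine lintegral_mono fun y => ?_
      refine indicator_apply_le' (fun (hy : 0 < y) => ?_) fun _ => zero_le
      by_cases h : √(y ^ 2 + r ^ 2) < β
      · have h1 : y < β := (Real.le_sqrt_of_sq_le (by nlinarith)).trans_lt h
        have h2 : r < β := (Real.le_sqrt_of_sq_le (by nlinarith)).trans_lt h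
        rw [indicator_of_mem (show √(y ^ 2 + r ^ 2) ∈ Iio β from h),
          indicator_of_mem (show y ∈ Ioo 0 β from ⟨hy, h1⟩),
          indicator_of_mem (show r ∈ Iio β from h2)]
        simp only [Pi.one_apply, mul_one]
        exact ENNReal.ofReal_le_ofReal (by gcongr)
      · rw [indicator_of_notMem (show √(y ^ 2 + r ^ 2) ∉ Iio β from h), mul_zero]
        exact zero_le
    _ = _ := by
      rw [lintegral_indicator measurableSet_Ioo, setLIntegral_const, Real.volume_Ioo, sub_zero]
      ring

theorem lintegral_radial_lt_top {j k ℓ : ℕ} (hj : 0 < j) (hk : 0 < k) (hℓ : 0 < ℓ)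
    {N : ℝ → ENNReal} (hN : Measurable N) {a β : ℝ} (ha : 0 < a) (hβ : a ≤ β)
    (h1 : ∫⁻ t in Ioo 0 a, ENNReal.ofReal (t ^ (ℓ + k - 1)) * N t ≠ ⊤)
    (h2 : ∫⁻ t in Ioi a, ENNReal.ofReal (t ^ (k - 1)) * N t ≠ ⊤) :
    ∫⁻ s in Ioi (0 : ℝ), ∫⁻ r in Ioo 0 s,
      (ENNReal.ofReal ((s ^ 2 - r ^ 2) ^ ((j : ℝ) / 2 - 1) * s) * (Iio β).indicator 1 s) *
        ∫⁻ t in Ioi r, ENNReal.ofReal (r ^ (ℓ - 1) * ((t ^ 2 - r ^ 2) ^ ((k : ℝ) / 2 - 1) * t)) *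
          N t < ⊤ := by
  have hβ0 : 0 < β := ha.trans_le hβ
  have hχ : Measurable ((Iio β).indicator (1 : ℝ → ENNReal)) :=
    measurable_one.indicator measurableSet_Iio
  set B : ℝ → ℝ → ENNReal := fun r t =>
    ENNReal.ofReal (r ^ (ℓ - 1) * ((t ^ 2 - r ^ 2) ^ ((k : ℝ) / 2 - 1) * t)) with hB
  have hBm : Measurable (Function.uncurry B) := by
    simp only [hB, Function.uncurry_def]
    fun_prop
  have hBNm : Measurable (Function.uncurry fun r t => B r t * N t) := by
    simp only [hB, Function.uncurry_def]
    fun_prop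
  have hJ : Measurable fun r => ∫⁻ t in Ioi r, B r t * N t := measurable_lintegral_Ioi hBNm
  set C₁ := ENNReal.ofReal (β ^ (j - 1)) * ENNReal.ofReal β with hC₁
  have hC₁t : C₁ ≠ ⊤ := ENNReal.mul_ne_top ENNReal.ofReal_ne_top ENNReal.ofReal_ne_top
  set C₂ := ∫⁻ r in Ioo 0 1, ENNReal.ofReal (projDensity (ℓ + k) k 1 r) with hC₂
  have hC₂t : C₂ ≠ ⊤ := lintegral_projDensity_one_ne_top hk (by omega)
  set C₃ := ENNReal.ofReal (2 * β ^ (ℓ - 1) * β) with hC₃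
  set C₄ := C₂ * ENNReal.ofReal ((2 * β) ^ ℓ) + C₃ with hC₄
  have hC₄t : C₄ ≠ ⊤ := ENNReal.add_ne_top.2
    ⟨ENNReal.mul_ne_top hC₂t ENNReal.ofReal_ne_top, ENNReal.ofReal_ne_top⟩
  set W : ℝ → ENNReal := fun t => ∫⁻ r in Ioo 0 t, (Iio β).indicator 1 r * B r t with hW
  have hW1 : ∀ t, 0 < t → W t ≤ C₂ * ENNReal.ofReal (t ^ (ℓ + k - 1)) := fun t ht => by
    rw [hC₂, ← lintegral_Ioo_kernel_eq hℓ ht]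
    refine lintegral_mono fun r => ?_
    by_cases hr : r ∈ Iio β
    · simp [hr, hB]
    · simp [hr]
  -- For t ≥ 2β the cutoff r < β keeps r away from the singularity at r = t; for t ≤ 2β the surplus
  -- power t^ℓ in the general bound is at most (2β)^ℓ.
  have hW2 : ∀ t, a < t → W t ≤ C₄ * ENNReal.ofReal (t ^ (k - 1)) := fun t ht => by
    have ht0 : 0 < t := ha.trans ht
    rw [hC₄, add_mul]
    rcases le_total (2 * β) t with h | h
    · exact (lintegral_Ioo_kernel_le hk hβ0 h).trans le_add_self
    · refine (hW1 t ht0).trans (le_trans ?_ le_self_add)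
      rw [mul_assoc, ← ENNReal.ofReal_mul (by positivity)]
      gcongr
      rw [show ℓ + k - 1 = ℓ + (k - 1) by omega, pow_add]
      gcongr
  calc
    _ = ∫⁻ r in Ioi (0 : ℝ), ∫⁻ s in Ioi r,
          (ENNReal.ofReal ((s ^ 2 - r ^ 2) ^ ((j : ℝ) / 2 - 1) * s) * (Iio β).indicator 1 s) *
            ∫⁻ t in Ioi r, B r t * N t := by
      refine (lintegral_Ioi_Ioi_swap _ ?_).symm
      exact ((by fun_prop : Measurable fun p : ℝ × ℝ =>
        ENNReal.ofReal ((p.2 ^ 2 - p.1 ^ 2) ^ ((j : ℝ) / 2 - 1) * p.2)).mul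
          (hχ.comp measurable_snd)).mul (hJ.comp measurable_fst)
    _ ≤ ∫⁻ r in Ioi (0 : ℝ), C₁ * ((Iio β).indicator 1 r * ∫⁻ t in Ioi r, B r t * N t) := by
      refine setLIntegral_mono (by fun_prop) fun r hr => ?_
      rw [lintegral_mul_const _ (by fun_prop), ← mul_assoc]
      gcongr
      exact lintegral_Ioi_indicator_le hj (le_of_lt hr)
    _ = C₁ * ∫⁻ r in Ioi (0 : ℝ), ∫⁻ t in Ioi r, (Iio β).indicator 1 r * (B r t * N t) := by
      rw [lintegral_const_mul _ (by fun_prop)]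
      congr 2 with r
      rw [lintegral_const_mul]
      exact hBNm.comp measurable_prodMk_left
    _ = C₁ * ∫⁻ t in Ioi (0 : ℝ), W t * N t := by
      rw [lintegral_Ioi_Ioi_swap]
      · congr 2 with t
        rw [hW, ← lintegral_mul_const]
        · congr 1 with r
          ring
        · exact hχ.mul (hBm.comp measurable_prodMk_right)
      · exact (hχ.comp measurable_fst).mul hBNm
    _ ≤ C₁ * ((∫⁻ t in Ioo 0 a, C₂ * (ENNReal.ofReal (t ^ (ℓ + k - 1)) * N t)) +
          ∫⁻ t in Ioi a, C₄ * (ENNReal.ofReal (t ^ (k - 1)) * N t)) := by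
      gcongr
      have : Ioi (0 : ℝ) = Ioc 0 a ∪ Ioi a := (Ioc_union_Ioi_eq_Ioi ha.le).symm
      rw [this]
      refine (lintegral_union_le _ _ _).trans (add_le_add ?_ ?_)
      · rw [setLIntegral_congr Ioo_ae_eq_Ioc.symm]
        refine setLIntegral_mono (by fun_prop) fun t ht => ?_
        rw [← mul_assoc]
        gcongr
        exact hW1 t ht.1
      · refine setLIntegral_mono (by fun_prop) fun t ht => ?_
        rw [← mul_assoc]
        gcongr
        exact hW2 t ht
    _ < ⊤ := by
      rw [lintegral_const_mul _ (by fun_prop), lintegral_const_mul _ (by fun_prop)]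
      exact ENNReal.mul_lt_top hC₁t.lt_top (ENNReal.add_lt_top.2
        ⟨ENNReal.mul_lt_top hC₂t.lt_top h1.lt_top, ENNReal.mul_lt_top hC₄t.lt_top h2.lt_top⟩)

end RadialEstimates

/-! ### Erdélyi–Kober form, convergence and local integrability -/

section RadialTransform

variable {n j k : ℕ}

lemma radialConst_eq (hj : 0 < j) (hk : 0 < k) (hjk : j + k < n) (s : ℝ) :
    radialConst n j k s =
      (Real.pi ^ ((k : ℝ) / 2) * Real.Gamma (((n : ℝ) - k) / 2)
        / Real.Gamma (((n : ℝ) - j - k) / 2) * s ^ ((k : ℤ) + 2 - n)) *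
        ((2 / Real.Gamma ((j : ℝ) / 2)) * (2 / Real.Gamma ((k : ℝ) / 2))) := by
  have hπ := Real.pi_pos
  have hj' : (0 : ℝ) < j := by exact_mod_cast hj
  have hk' : (0 : ℝ) < k := by exact_mod_cast hk
  have hl' : (0 : ℝ) < (n : ℝ) - j - k := by
    have : ((j + k : ℕ) : ℝ) < n := by exact_mod_cast hjk
    push_cast at this
    linarith
  have e1 : ((n - j - k : ℕ) : ℝ) = (n : ℝ) - j - k := by
    rw [Nat.cast_sub (by omega), Nat.cast_sub (by omega)]
  have e2 : ((n - k : ℕ) : ℝ) = (n : ℝ) - k := Nat.cast_sub (by omega)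
  have g1 := Real.Gamma_pos_of_pos (show 0 < (j : ℝ) / 2 by positivity)
  have g2 := Real.Gamma_pos_of_pos (show 0 < (k : ℝ) / 2 by positivity)
  have g3 := Real.Gamma_pos_of_pos (show 0 < ((n : ℝ) - j - k) / 2 by positivity)
  have g4 := Real.Gamma_pos_of_pos (show 0 < ((n : ℝ) - k) / 2 by linarith)
  have hp : Real.pi ^ (((n : ℝ) - k) / 2) =
      Real.pi ^ ((j : ℝ) / 2) * Real.pi ^ (((n : ℝ) - j - k) / 2) := by
    rw [← Real.rpow_add hπ]
    congr 1
    ring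
  have p1 := Real.rpow_pos_of_pos hπ ((j : ℝ) / 2)
  have p2 := Real.rpow_pos_of_pos hπ (((n : ℝ) - j - k) / 2)
  rw [radialConst, sphereArea, sphereArea, sphereArea, sphereArea, e1, e2, hp]
  field_simp

theorem radialTransform_eq_erdelyiKober (hj : 0 < j) (hk : 0 < k) (hjk : j + k < n) (f₀ : ℝ → ℂ)
    (s : ℝ) :
    radialTransform n j k f₀ s =
      (Real.pi ^ ((k : ℝ) / 2) * Real.Gamma (((n : ℝ) - k) / 2)
        / Real.Gamma (((n : ℝ) - j - k) / 2) * s ^ ((k : ℤ) + 2 - n)) •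
        erdelyiKoberPlus ((j : ℝ) / 2)
          (fun r => r ^ ((n : ℤ) - j - k - 2) • erdelyiKoberMinus ((k : ℝ) / 2) f₀ r) s := by
  change radialConst n j k s • _ = _
  rw [radialConst_eq hj hk hjk, mul_smul]
  congr 1
  rw [erdelyiKoberPlus, mul_smul, ← integral_smul]
  congr 1
  refine setIntegral_congr_fun measurableSet_Ioo fun r hr => ?_
  have hr0 : 0 < r := hr.1
  -- Since ℓ - 2 may be -1, the power on the right needs an integer exponent.
  have hz : r ^ (n - j - k - 1) = r * r ^ ((n : ℤ) - j - k - 2) := by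
    rw [← zpow_natCast, ← zpow_one_add₀ hr0.ne']
    congr 1
    omega
  simp only [erdelyiKoberMinus, smul_smul, hz]
  congr 1
  ring

lemma RadialTransformExists.congr {f₀ g₀ : ℝ → ℂ} (h : f₀ =ᵐ[volume.restrict (Ioi 0)] g₀) (s : ℝ) :
    RadialTransformExists n j k f₀ s ↔ RadialTransformExists n j k g₀ s := by
  have h1 : (fun p : ℝ × ℝ => f₀ p.2) =ᵐ[volume.restrict (radialDomain s)] fun p => g₀ p.2 :=
    ae_mono (restrict_radialDomain_le s)
      ((Measure.quasiMeasurePreserving_snd (μ := (volume : Measure ℝ))).ae_eq_comp h)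
  refine integrable_congr ?_
  filter_upwards [h1] with p hp
  rw [hp]

lemma radialTransform_congr {f₀ g₀ : ℝ → ℂ} (h : f₀ =ᵐ[volume.restrict (Ioi 0)] g₀) :
    radialTransform n j k f₀ = radialTransform n j k g₀ := by
  funext s
  unfold radialTransform
  congr 1
  refine setIntegral_congr_fun measurableSet_Ioo fun r hr => ?_
  congr 1
  refine integral_congr_ae ?_
  filter_upwards [ae_mono (Measure.restrict_mono (Ioi_subset_Ioi hr.1.le) le_rfl) h] with t ht
  rw [ht]

lemma lintegral_enorm_radialDomain {g : ℝ → ℂ} (hg : Measurable g) (s : ℝ) :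
    ∫⁻ p in radialDomain s, ‖radialKernel n j k s p • g p.2‖ₑ =
      ∫⁻ r in Ioo 0 s, ENNReal.ofReal ((s ^ 2 - r ^ 2) ^ ((j : ℝ) / 2 - 1)) *
        ∫⁻ t in Ioi r, ENNReal.ofReal
          (r ^ (n - j - k - 1) * ((t ^ 2 - r ^ 2) ^ ((k : ℝ) / 2 - 1) * t)) * ‖g t‖ₑ := by
  have hrk := measurable_radialKernel n j k s
  rw [lintegral_radialDomain (by fun_prop)]
  refine setLIntegral_congr_fun measurableSet_Ioo fun r hr => ?_
  simp only
  rw [← lintegral_const_mul _ (by fun_prop)]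
  refine setLIntegral_congr_fun measurableSet_Ioi fun t ht => ?_
  have h0 : 0 < s ^ 2 - r ^ 2 := by nlinarith [hr.1, hr.2]
  have hp : 0 < radialKernel n j k s (r, t) := radialKernel_pos ⟨hr.1, hr.2, ht⟩
  rw [enorm_smul, Real.enorm_of_nonneg hp.le, ← mul_assoc,
    ← ENNReal.ofReal_mul (by positivity), radialKernel, mul_assoc]

lemma measurable_lintegral_enorm (n j k : ℕ) {g : ℝ → ℂ} (hg : Measurable g) :
    Measurable fun s => ∫⁻ p in radialDomain s, ‖radialKernel n j k s p • g p.2‖ₑ := by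
  have hS : MeasurableSet {q : ℝ × (ℝ × ℝ) | q.2 ∈ radialDomain q.1} :=
    (measurableSet_lt measurable_const (measurable_fst.comp measurable_snd)).inter
      ((measurableSet_lt (measurable_fst.comp measurable_snd) measurable_fst).inter
        (measurableSet_lt (measurable_fst.comp measurable_snd)
          (measurable_snd.comp measurable_snd)))
  have hm : Measurable fun q : ℝ × (ℝ × ℝ) => ‖radialKernel n j k q.1 q.2 • g q.2.2‖ₑ := by
    unfold radialKernel
    fun_prop
  have := (hm.indicator hS).lintegral_prod_right' (ν := volume)
  convert this using 2 with s
  rw [← lintegral_indicator (measurableSet_radialDomain s)]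
  rfl

lemma stronglyMeasurable_radialTransform (n j k : ℕ) {g : ℝ → ℂ} (hg : Measurable g) :
    StronglyMeasurable (radialTransform n j k g) := by
  have hm1 : StronglyMeasurable ({p : ℝ × ℝ | p.1 < p.2}.indicator fun p : ℝ × ℝ =>
      ((p.2 ^ 2 - p.1 ^ 2) ^ ((k : ℝ) / 2 - 1) * p.2) • g p.2) :=
    (Measurable.stronglyMeasurable (by fun_prop)).indicator
      (measurableSet_lt measurable_fst measurable_snd)
  have h1 : StronglyMeasurable fun r : ℝ =>
      ∫ t in Ioi r, ((t ^ 2 - r ^ 2) ^ ((k : ℝ) / 2 - 1) * t) • g t := by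
    convert hm1.integral_prod_right' (ν := volume) using 2 with r
    rw [← integral_indicator measurableSet_Ioi]
    rfl
  have hm2 : StronglyMeasurable ({p : ℝ × ℝ | 0 < p.2 ∧ p.2 < p.1}.indicator fun p : ℝ × ℝ =>
      ((p.1 ^ 2 - p.2 ^ 2) ^ ((j : ℝ) / 2 - 1) * p.2 ^ (n - j - k - 1)) •
        ∫ t in Ioi p.2, ((t ^ 2 - p.2 ^ 2) ^ ((k : ℝ) / 2 - 1) * t) • g t) :=
    (StronglyMeasurable.smul (Measurable.stronglyMeasurable
      (by fun_prop : Measurable fun p : ℝ × ℝ =>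
        (p.1 ^ 2 - p.2 ^ 2) ^ ((j : ℝ) / 2 - 1) * p.2 ^ (n - j - k - 1)))
      (h1.comp_measurable measurable_snd)).indicator
      ((measurableSet_lt measurable_const measurable_snd).inter
        (measurableSet_lt measurable_snd measurable_fst))
  have h2 : StronglyMeasurable fun s : ℝ =>
      ∫ r in Ioo 0 s, ((s ^ 2 - r ^ 2) ^ ((j : ℝ) / 2 - 1) * r ^ (n - j - k - 1)) •
        ∫ t in Ioi r, ((t ^ 2 - r ^ 2) ^ ((k : ℝ) / 2 - 1) * t) • g t := by
    convert hm2.integral_prod_right' (ν := volume) using 2 with s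
    rw [← integral_indicator measurableSet_Ioo]
    rfl
  have h3 : Measurable (radialConst n j k) := by
    unfold radialConst
    fun_prop
  exact h3.stronglyMeasurable.smul h2

lemma radialTransformExists_iff {g : ℝ → ℂ} (hg : Measurable g) (s : ℝ) :
    RadialTransformExists n j k g s ↔
      ∫⁻ p in radialDomain s, ‖radialKernel n j k s p • g p.2‖ₑ < ⊤ := by
  have hrk := measurable_radialKernel n j k s
  have hm : AEStronglyMeasurable (fun p : ℝ × ℝ => radialKernel n j k s p • g p.2)
      (volume.restrict (radialDomain s)) :=
    (Measurable.stronglyMeasurable (by fun_prop)).aestronglyMeasurable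
  exact and_iff_right hm

lemma enorm_radialTransform_le (hj : 0 < j) (hk : 0 < k) (hjk : j + k < n) {g : ℝ → ℂ}
    {s : ℝ} (hs : 0 < s) (h : RadialTransformExists n j k g s) :
    ‖radialTransform n j k g s‖ₑ ≤ ENNReal.ofReal (radialConst n j k s) *
      ∫⁻ p in radialDomain s, ‖radialKernel n j k s p • g p.2‖ₑ := by
  rw [radialTransform_eq_setIntegral h, enorm_smul,
    Real.enorm_of_nonneg (radialConst_pos hj hk hjk hs).le]
  gcongr
  exact enorm_integral_le_lintegral_enorm _

/-- The extra weight s completes (s² - r²)^(j/2-1) to the kernel of the substitution s = √(y² + r²).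
It is harmless away from s = 0. -/
lemma lintegral_Ioo_radial_lt_top (hj : 0 < j) (hk : 0 < k) (hjk : j + k < n) {g : ℝ → ℂ}
    (hg : Measurable g) {a β : ℝ} (ha : 0 < a) (hβ : a ≤ β)
    (h1 : IntegrableOn (fun t => t ^ (n - j - 1) • g t) (Ioo 0 a))
    (h2 : IntegrableOn (fun t => t ^ (k - 1) • g t) (Ioi a)) :
    ∫⁻ s in Ioo 0 β, ENNReal.ofReal s *
      ∫⁻ p in radialDomain s, ‖radialKernel n j k s p • g p.2‖ₑ < ⊤ := by
  have hf (m : ℕ) {S : Set ℝ} (hS : MeasurableSet S) (hS0 : S ⊆ Ioi 0)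
      (h : IntegrableOn (fun t => t ^ m • g t) S) :
      ∫⁻ t in S, ENNReal.ofReal (t ^ m) * ‖g t‖ₑ ≠ ⊤ := by
    have := h.2.ne
    convert this using 1
    refine setLIntegral_congr_fun hS fun t ht => ?_
    have ht0 : 0 < t := hS0 ht
    simp only
    rw [enorm_smul, Real.enorm_of_nonneg (by positivity)]
  have hmain := lintegral_radial_lt_top (j := j) (k := k) (ℓ := n - j - k) hj hk (by omega)
    (N := fun t => ‖g t‖ₑ) (by fun_prop) ha hβ
    (by
      have := hf _ measurableSet_Ioo Ioo_subset_Ioi_self h1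
      rwa [show n - j - k + k - 1 = n - j - 1 by omega])
    (hf _ measurableSet_Ioi (Ioi_subset_Ioi ha.le) h2)
  refine lt_of_le_of_lt ?_ hmain
  rw [← lintegral_indicator measurableSet_Ioo, ← lintegral_indicator measurableSet_Ioi]
  refine lintegral_mono fun s => ?_
  refine indicator_apply_le' (fun hs => ?_) fun _ => zero_le
  have hs0 : 0 < s := hs.1
  rw [indicator_of_mem (show s ∈ Ioi 0 from hs0), lintegral_enorm_radialDomain hg,
    indicator_of_mem (show s ∈ Iio β from hs.2)]
  rw [← lintegral_const_mul' _ _ ENNReal.ofReal_ne_top]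
  refine le_of_eq (setLIntegral_congr_fun measurableSet_Ioo fun r hr => ?_)
  have h0 : 0 < s ^ 2 - r ^ 2 := by nlinarith [hr.1, hr.2]
  simp only [Pi.one_apply, mul_one]
  rw [← mul_assoc, ← ENNReal.ofReal_mul hs0.le, mul_comm s]

theorem ae_radialTransformExists (hj : 0 < j) (hk : 0 < k) (hjk : j + k < n) {g : ℝ → ℂ}
    (hg : Measurable g) {a : ℝ} (ha : 0 < a)
    (h1 : IntegrableOn (fun t => t ^ (n - j - 1) • g t) (Ioo 0 a))
    (h2 : IntegrableOn (fun t => t ^ (k - 1) • g t) (Ioi a)) :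
    ∀ᵐ s ∂(volume.restrict (Ioi (0 : ℝ))), RadialTransformExists n j k g s := by
  have hm := measurable_lintegral_enorm n j k hg
  -- The Tonelli estimate needs a bounded range of s, so the half-line is exhausted by countably
  -- many intervals.
  have h (N : ℕ) : ∀ᵐ s : ℝ, s ∈ Ioo 0 (a + N) → RadialTransformExists n j k g s := by
    have := lintegral_Ioo_radial_lt_top hj hk hjk hg ha (β := a + N) (by simp) h1 h2
    have := ae_lt_top (by fun_prop) this.ne
    rw [ae_restrict_iff' measurableSet_Ioo] at this
    filter_upwards [this] with s hs hsN
    rw [radialTransformExists_iff hg]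
    have hs0 : ENNReal.ofReal s ≠ 0 := by simpa using hsN.1
    by_contra htop
    have := hs hsN
    rw [not_lt_top_iff.1 htop, ENNReal.mul_top hs0] at this
    exact lt_irrefl _ this
  rw [ae_restrict_iff' measurableSet_Ioi]
  filter_upwards [ae_all_iff.2 h] with s hs hs0
  obtain ⟨N, hN⟩ := exists_nat_gt s
  exact hs N ⟨hs0, by linarith⟩

theorem integrableOn_radialTransform (hj : 0 < j) (hk : 0 < k) (hjk : j + k < n) {g : ℝ → ℂ}
    (hg : Measurable g) {a : ℝ} (ha : 0 < a)
    (h1 : IntegrableOn (fun t => t ^ (n - j - 1) • g t) (Ioo 0 a))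
    (h2 : IntegrableOn (fun t => t ^ (k - 1) • g t) (Ioi a)) {α β : ℝ} (hα : 0 < α) :
    IntegrableOn (radialTransform n j k g) (Icc α β) := by
  refine ⟨(stronglyMeasurable_radialTransform n j k hg).aestronglyMeasurable, ?_⟩
  have hm := measurable_lintegral_enorm n j k hg
  have hex := ae_radialTransformExists hj hk hjk hg ha h1 h2
  have hsub : Icc α β ⊆ Ioo 0 (a + |β| + 1) := fun s hs =>
    ⟨hα.trans_le hs.1, by linarith [hs.2, le_abs_self β]⟩
  have hsub' : Icc α β ⊆ Ioi 0 := fun s hs => hα.trans_le hs.1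
  have hfin := lintegral_Ioo_radial_lt_top hj hk hjk hg ha (β := a + |β| + 1)
    (by linarith [abs_nonneg β]) h1 h2
  -- Dividing by s removes the auxiliary weight; the quotient is bounded because α > 0.
  obtain ⟨C, hC⟩ : ∃ C, ∀ s ∈ Icc α β, radialConst n j k s / s ≤ C := by
    have hcont : ContinuousOn (fun s => radialConst n j k s / s) (Icc α β) := by
      unfold radialConst
      refine ContinuousOn.div (continuousOn_const.mul (ContinuousOn.zpow₀ continuousOn_id _
        fun s hs => Or.inl (hsub' hs).ne')) continuousOn_id fun s hs => (hsub' hs).ne'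
    obtain ⟨C, hC⟩ := isCompact_Icc.exists_bound_of_continuousOn hcont
    exact ⟨C, fun s hs => (le_abs_self _).trans (hC s hs)⟩
  calc
    ∫⁻ s in Icc α β, ‖radialTransform n j k g s‖ₑ ≤ ∫⁻ s in Icc α β, ENNReal.ofReal C *
        (ENNReal.ofReal s * ∫⁻ p in radialDomain s, ‖radialKernel n j k s p • g p.2‖ₑ) := by
      refine lintegral_mono_ae ?_
      filter_upwards [ae_restrict_mem measurableSet_Icc,
        ae_mono (Measure.restrict_mono hsub' le_rfl) hex] with s hs hse
      have hs0 : 0 < s := hsub' hs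
      refine (enorm_radialTransform_le hj hk hjk hs0 hse).trans ?_
      rw [← mul_assoc]
      gcongr
      rw [← ENNReal.ofReal_mul' hs0.le]
      exact ENNReal.ofReal_le_ofReal ((div_le_iff₀ hs0).1 (hC s hs))
    _ ≤ ENNReal.ofReal C * ∫⁻ s in Ioo 0 (a + |β| + 1),
        (ENNReal.ofReal s * ∫⁻ p in radialDomain s, ‖radialKernel n j k s p • g p.2‖ₑ) := by
      rw [lintegral_const_mul _ (by fun_prop)]
      gcongr
    _ < ⊤ := ENNReal.mul_lt_top ENNReal.ofReal_lt_top hfin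

/-- Integrability of t^m f₀ already contains measurability of f₀, recovered by dividing by t^m; the
point a is null. -/
lemma aestronglyMeasurable_Ioi_zero {p q : ℕ} {f₀ : ℝ → ℂ} {a : ℝ} (ha : 0 < a)
    (h1 : IntegrableOn (fun t => t ^ p • f₀ t) (Ioo 0 a))
    (h2 : IntegrableOn (fun t => t ^ q • f₀ t) (Ioi a)) :
    AEStronglyMeasurable f₀ (volume.restrict (Ioi 0)) := by
  have key (m : ℕ) {S : Set ℝ} (hS : MeasurableSet S) (hS0 : S ⊆ Ioi 0)
      (h : IntegrableOn (fun t => t ^ m • f₀ t) S) :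
      AEStronglyMeasurable f₀ (volume.restrict S) := by
    have hi : Measurable fun t : ℝ => (t ^ m)⁻¹ := by fun_prop
    refine (hi.aestronglyMeasurable.smul h.1).congr ?_
    filter_upwards [ae_restrict_mem hS] with t ht
    have ht0 : 0 < t := hS0 ht
    exact inv_smul_smul₀ (pow_ne_zero m ht0.ne') _
  have e : Ioi (0 : ℝ) = Ioc 0 a ∪ Ioi a := (Ioc_union_Ioi_eq_Ioi ha.le).symm
  rw [e, aestronglyMeasurable_union_iff, ← Measure.restrict_congr_set Ioo_ae_eq_Ioc]
  exact ⟨key _ measurableSet_Ioo Ioo_subset_Ioi_self h1,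
    key _ measurableSet_Ioi (Ioi_subset_Ioi ha.le) h2⟩

theorem mixedRadon_radial (hj : 0 < j) (hk : 0 < k) (hjk : j + k < n) (f : AffGr n j → ℂ)
    (f₀ : ℝ → ℂ) (hf : ∀ τ : AffGr n j, 0 < τ.dist0 → f τ = f₀ τ.dist0)
    (hint : ∃ a : ℝ, 0 < a ∧ IntegrableOn (fun t => t ^ (n - j - 1) • f₀ t) (Ioo 0 a) ∧
      IntegrableOn (fun t => t ^ (k - 1) • f₀ t) (Ioi a)) :
    (∀ ζ : AffGr n k, 0 < ζ.dist0 →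
      (MixedRadonExists f ζ ↔ RadialTransformExists n j k f₀ ζ.dist0) ∧
      (MixedRadonExists f ζ → mixedRadon f ζ = radialTransform n j k f₀ ζ.dist0)) ∧
    (∀ᵐ s ∂(volume.restrict (Ioi (0 : ℝ))), RadialTransformExists n j k f₀ s) ∧
    (∀ s : ℝ, 0 < s →
      radialTransform n j k f₀ s =
        (Real.pi ^ ((k : ℝ) / 2) * Real.Gamma (((n : ℝ) - k) / 2)
            / Real.Gamma (((n : ℝ) - j - k) / 2) * s ^ ((k : ℤ) + 2 - n)) •
          erdelyiKoberPlus ((j : ℝ) / 2)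
            (fun r => r ^ ((n : ℤ) - j - k - 2) • erdelyiKoberMinus ((k : ℝ) / 2) f₀ r) s) ∧
    (∀ α β : ℝ, 0 < α → α < β → IntegrableOn (radialTransform n j k f₀) (Icc α β)) := by
  obtain ⟨a, ha, h1, h2⟩ := hint
  have hm := aestronglyMeasurable_Ioi_zero ha h1 h2
  -- The estimates need a Borel function. Replacing f₀ by a measurable representative changes
  -- neither convergence nor the value of the transform at any s.
  have hg : Measurable (hm.mk f₀) := hm.stronglyMeasurable_mk.measurable
  have hfg := hm.ae_eq_mk
  have hint (m : ℕ) {S : Set ℝ} (hS0 : S ⊆ Ioi 0) (h : IntegrableOn (fun t => t ^ m • f₀ t) S) :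
      IntegrableOn (fun t => t ^ m • hm.mk f₀ t) S := by
    refine h.congr ?_
    filter_upwards [ae_mono (Measure.restrict_mono hS0 le_rfl) hfg] with t ht
    rw [ht]
  have h1' := hint _ (S := Ioo 0 a) Ioo_subset_Ioi_self h1
  have h2' := hint _ (S := Ioi a) (Ioi_subset_Ioi ha.le) h2
  refine ⟨fun ζ hζ => ⟨mixedRadonExists_iff hj hk hjk hf hm ζ hζ,
    mixedRadon_eq_radialTransform hj hk hjk hf hm ζ hζ⟩, ?_,
    fun s _ => radialTransform_eq_erdelyiKober hj hk hjk f₀ s, fun α β hα _ => ?_⟩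
  · filter_upwards [ae_radialTransformExists hj hk hjk hg ha h1' h2'] with s hs
    exact (RadialTransformExists.congr hfg s).2 hs
  · rw [radialTransform_congr hfg]
    exact integrableOn_radialTransform hj hk hjk hg ha h1' h2' hα

end RadialTransform

end

theorem mainTheorem6 (n j k : ℕ) (hj : 0 < j) (hk : 0 < k) (hjk : j + k < n) :
    -- the transform `R_{j,k}`
    (∀ (f : AffGr n j → ℂ) (f₀ : ℝ → ℂ),
      (∀ τ : AffGr n j, 0 < τ.dist0 → f τ = f₀ τ.dist0) →
      (∃ a : ℝ, 0 < a ∧ IntegrableOn (fun t => t ^ (n - j - 1) • f₀ t) (Ioo 0 a) ∧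
        IntegrableOn (fun t => t ^ (k - 1) • f₀ t) (Ioi a)) →
      (∀ ζ : AffGr n k, 0 < ζ.dist0 →
        (MixedRadonExists f ζ ↔ RadialTransformExists n j k f₀ ζ.dist0) ∧
        (MixedRadonExists f ζ → mixedRadon f ζ = radialTransform n j k f₀ ζ.dist0)) ∧
      (∀ᵐ s ∂(volume.restrict (Ioi (0 : ℝ))), RadialTransformExists n j k f₀ s) ∧
      (∀ s : ℝ, 0 < s →
        radialTransform n j k f₀ s =
          (Real.pi ^ ((k : ℝ) / 2) * Real.Gamma (((n : ℝ) - k) / 2)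
              / Real.Gamma (((n : ℝ) - j - k) / 2) * s ^ ((k : ℤ) + 2 - n)) •
            erdelyiKoberPlus ((j : ℝ) / 2)
              (fun r => r ^ ((n : ℤ) - j - k - 2) • erdelyiKoberMinus ((k : ℝ) / 2) f₀ r) s) ∧
      (∀ α β : ℝ, 0 < α → α < β → IntegrableOn (radialTransform n j k f₀) (Icc α β))) ∧
    -- the dual transform `R_{k,j}`
    (∀ (φ : AffGr n k → ℂ) (φ₀ : ℝ → ℂ),
      (∀ ζ : AffGr n k, 0 < ζ.dist0 → φ ζ = φ₀ ζ.dist0) →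
      (∃ a : ℝ, 0 < a ∧ IntegrableOn (fun s => s ^ (n - k - 1) • φ₀ s) (Ioo 0 a) ∧
        IntegrableOn (fun s => s ^ (j - 1) • φ₀ s) (Ioi a)) →
      (∀ τ : AffGr n j, 0 < τ.dist0 →
        (MixedRadonExists φ τ ↔ RadialTransformExists n k j φ₀ τ.dist0) ∧
        (MixedRadonExists φ τ → mixedRadon φ τ = radialTransform n k j φ₀ τ.dist0)) ∧
      (∀ᵐ t ∂(volume.restrict (Ioi (0 : ℝ))), RadialTransformExists n k j φ₀ t) ∧
      (∀ t : ℝ, 0 < t →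
        radialTransform n k j φ₀ t =
          (Real.pi ^ ((j : ℝ) / 2) * Real.Gamma (((n : ℝ) - j) / 2)
              / Real.Gamma (((n : ℝ) - j - k) / 2) * t ^ ((j : ℤ) + 2 - n)) •
            erdelyiKoberPlus ((k : ℝ) / 2)
              (fun r => r ^ ((n : ℤ) - j - k - 2) • erdelyiKoberMinus ((j : ℝ) / 2) φ₀ r) t) ∧
      (∀ α β : ℝ, 0 < α → α < β → IntegrableOn (radialTransform n k j φ₀) (Icc α β))) := by
  refine ⟨mixedRadon_radial hj hk hjk, fun φ φ₀ hφ hint => ?_⟩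
  -- Interchanging j and k yields n - k - j where the statement has n - j - k.
  have h := mixedRadon_radial hk hj (by omega) φ φ₀ hφ hint
  rwa [sub_right_comm (n : ℝ) k j, sub_right_comm (n : ℤ) k j] at h
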